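/- Write $(a)_n := a(a+1)\cdots(a+n-1)$. Let $\alpha<1$ and let $V=(V_{n,k}: n\ge k\ge 1)$ be a triangular array of nonnegative reals with $V_{1,1}=1$ and $V_{n,k}=(n-\alpha k)V_{n+1,k}+V_{n+1,k+1}$. Let $\Pi$ be a (necessarily exchangeable) random partition of $\{1,2,\dots\}$ of Gibbs type with parameters $(\alpha,V)$: for all $n\ge 1$ and every partition $\{A_1,\dots,A_k\}$ of $\{1,\dots,n\}$, the restriction of $\Pi$ to $\{1,\dots,n\}$ equals $\{A_1,\dots,A_k\}$ with probability $V_{n,k}\prod_{\ell=1}^k(1-\alpha)_{|A_\ell|-1}$. Let $\mu_1$ be its structural distribution, i.e. the law of the almost sure limit $P_1=\lim_n N_{n,1}/n$, where $N_{n,1}$ is the number of elements of $\{1,\dots,n\}$ in the block containing $1$, and assume $P_1>0$ almost surely, so that $\mu_1$ is a distribution on $(0,1]$. For $n\ge1$ define $$\Phi_n^{z_1,z_2}:=\sum_{k=1}^n \frac{V_{n+z_1,k+z_2}}{\alpha^k}\,\mathscr C(n,k;\alpha),\qquad \mathscr C(n,k;\alpha):=\frac1{k!}\sum_{i=0}^k(-1)^i\binom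 ki(-i\alpha)_n,$$ where for $\alpha=0$ the ratio $\mathscr C(n,k;\alpha)/\alpha^k$ is read as its limit as $\alpha\to0$, the unsigned Stirling number of the first kind; and set $\Phi_0^{n,1}:=V_{n,1}$. Let $\Omega$ be a Polish space with its Borel $\sigma$-algebra, and let $B_0$ be a non-atomic measure on $\Omega$ with total mass $\gamma=B_0(\Omega)\in(0,\infty)$. Let $B=\sum_k b_k\delta_{\omega_k}$ be the Gibbs-type beta process: the $(\omega_k,b_k)$ are the (finitely or infinitely many) points of a Poisson process on $\Omega\times(0,1]$ with intensity $B_0(d\omega)\,p^{-1}\mu_1(dp)$. Let $Z_j=\sum_k 1_{\{U_{j,k}<b_k\}}\delta_{\omega_k}$, $j\ge1$, with $U_{j,k}$ i.i.d. uniform on $(0,1)$, independent of the points $(\omega_k,b_k)$. For every $n$, let $K_n$ be the number of distinct atoms among $Z_1,\dots,Z_n$, denoted $\{\omega_1,\dots,\omega_{K_n}\}$, and let $S_{n,k}=\sum_{j=1}^n Z_j\{\omega_k\}$. Then the joint law of $(Z_1,\dots,Z_n)$ is $$p(Z_1,\dots,Z_n)=\gamma^{K_n}\exp\Bigl(-\gamma\sum_{j=1}^n\Phi_{j-1}^{1,1}\Bigr)\prod_{k=1}^{K_n}(1-\alpha)_{S_{n,k}-1}\,\Phi_{n-S_{n,k}}^{S_{n,k},1}\,\bar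 B_0(d\omega_k),\qquad \bar B_0:=\gamma^{-1}B_0,$$ as a density for the unordered collection of atoms. Precisely, for every measurable $F\ge0$ on $n$-tuples of measures on $\Omega$, $$\mathbb E\,F(Z_1,\dots,Z_n)=\sum_{K=0}^\infty\frac1{K!}\sum_{h_1,\dots,h_K}\int_{\Omega^K}F(z)\,\gamma^{K}\exp\Bigl(-\gamma\sum_{j=1}^n\Phi_{j-1}^{1,1}\Bigr)\prod_{k=1}^{K}(1-\alpha)_{|h_k|-1}\,\Phi_{n-|h_k|}^{|h_k|,1}\;\bar B_0(dx_1)\cdots\bar B_0(dx_K),$$ where $h_1,\dots,h_K$ range over the nonempty subsets of $\{1,\dots,n\}$ and $z=(z_1,\dots,z_n)$ with $z_j=\sum_{k:\,j\in h_k}\delta_{x_k}$. -/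

import Mathlib

open MeasureTheory ProbabilityTheory Filter Set
open scoped ENNReal Topology Nat

noncomputable section

namespace GibbsIBP

/-- The rising factorial `(a)_n = a (a + 1) ⋯ (a + n - 1)`. -/
def rising (a : ℝ) (n : ℕ) : ℝ := (ascPochhammer ℝ n).eval a

/-- The generalized factorial coefficient `𝒞(n, k; α)`. -/
def genFactCoeff (n k : ℕ) (α : ℝ) : ℝ :=
  1 / (k ! : ℝ) * ∑ i ∈ Finset.range (k + 1),
    (-1 : ℝ) ^ i * (k.choose i : ℝ) * rising (-((i : ℝ) * α)) n

/-- The ratio `𝒞(n, k; α) / α ^ k`. At `α = 0` it is understood as its limit as `α → 0`, which is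
the unsigned Stirling number of the first kind. -/
def genFactRatio (n k : ℕ) (α : ℝ) : ℝ :=
  if α = 0 then (n.stirlingFirst k : ℝ) else genFactCoeff n k α / α ^ k

/-- The primitives `Φ_n^{z₁, z₂}`, given for `n ≥ 1` by
`∑_{k=1}^n V_{n + z₁, k + z₂} 𝒞(n, k; α) / α ^ k`, with the convention
`Φ_0^{z₁, z₂} = V_{z₁, z₂}` (only `z₂ = 1` matters). -/
def primitive (α : ℝ) (V : ℕ → ℕ → ℝ) (n z₁ z₂ : ℕ) : ℝ :=
  if n = 0 then V z₁ z₂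
  else ∑ k ∈ Finset.Icc 1 n, V (n + z₁) (k + z₂) * genFactRatio n k α

/-- `α < 1` is a discount parameter and `V = (V_{n,k} : n ≥ k ≥ 1)` is a triangular array of Gibbs
weights for `α`. Values of `V` outside the triangle play no role. -/
structure IsGibbsWeights (α : ℝ) (V : ℕ → ℕ → ℝ) : Prop where
  discount_lt_one : α < 1
  nonneg : ∀ n k : ℕ, 1 ≤ k → k ≤ n → 0 ≤ V n k
  one_one : V 1 1 = 1
  recursion : ∀ n k : ℕ, 1 ≤ k → k ≤ n →
    V n k = ((n : ℝ) - α * k) * V (n + 1) k + V (n + 1) (k + 1)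

/-- A random partition `R` of the positive integers (the integer `i + 1` is represented by `i : ℕ`;
`R ξ` is the relation "in the same block") is of Gibbs type with parameters `(α, V)`: for every
partition `π` of the first `n` integers, the restriction of `R` equals `π` with probability
`V_{n,k} ∏_A (1 - α)_{|A| - 1}`, the product being over the `k` blocks `A` of `π`. As this depends
on block sizes only, such a partition is exchangeable. -/
structure IsGibbsPartition {Ξ : Type*} [MeasurableSpace Ξ] (P : Measure Ξ) (R : Ξ → Setoid ℕ)
    (α : ℝ) (V : ℕ → ℕ → ℝ) : Prop where
  weights : IsGibbsWeights α V
  measurable : ∀ i j : ℕ, MeasurableSet {ξ | R ξ i j}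
  eppf : ∀ n : ℕ, 1 ≤ n → ∀ π : Finpartition (Finset.univ : Finset (Fin n)),
    P {ξ | ∀ i j : Fin n, R ξ i j ↔ j ∈ π.part i} =
      ENNReal.ofReal (V n π.parts.card * ∏ A ∈ π.parts, rising (1 - α) (A.card - 1))

/-- The limiting relative frequency `P₁ = lim_n N_{n,1} / n` of the block containing the first
integer. For an exchangeable partition the limit exists almost surely; the `limsup` agrees with
it whenever it exists. -/
def firstFreq {Ξ : Type*} (R : Ξ → Setoid ℕ) (ξ : Ξ) : ℝ :=
  limsup (fun n : ℕ => ({j : ℕ | j < n ∧ R ξ 0 j}.ncard : ℝ) / n) atTop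

/-- The structural distribution `μ₁`, the law of `P₁`. -/
def structuralDist {Ξ : Type*} [MeasurableSpace Ξ] (P : Measure Ξ) (R : Ξ → Setoid ℕ) :
    Measure ℝ :=
  P.map (firstFreq R)

/-- The number of points in the set `A` of the point process with points `X 0, X 1, …`, of which
only the first `N` (possibly infinitely many) exist. -/
def pointCount {Ξ E : Type*} (N : Ξ → ℕ∞) (X : ℕ → Ξ → E) (A : Set E) (ξ : Ξ) : ℕ∞ :=
  {k : ℕ | (k : ℕ∞) < N ξ ∧ X k ξ ∈ A}.encard

/-- `(X k : k < N)` are the points of a Poisson process with (σ-finite) intensity measure `ν`. -/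
structure IsPoissonProcess {Ξ E : Type*} [MeasurableSpace Ξ] [MeasurableSpace E] (P : Measure Ξ)
    (N : Ξ → ℕ∞) (X : ℕ → Ξ → E) (ν : Measure E) : Prop where
  measurable_card : Measurable N
  measurable_point : ∀ k, Measurable (X k)
  poisson : ∀ A : Set E, MeasurableSet A → ν A ≠ ∞ →
    HasLaw (pointCount N X A) ((poissonMeasure (ν A).toNNReal).map (Nat.cast : ℕ → ℕ∞)) P
  indep : ∀ (m : ℕ) (A : Fin m → Set E), (∀ i, MeasurableSet (A i)) →
    Pairwise (fun i j => Disjoint (A i) (A j)) →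
    iIndepFun (fun i => pointCount N X (A i)) P

/-- The intensity `B₀(dω) p⁻¹ μ(dp)` on `Ω × (0, 1]`, as a measure on `Ω × ℝ`. -/
def betaIntensity {Ω : Type*} [MeasurableSpace Ω] (B₀ : Measure Ω) (μ : Measure ℝ) :
    Measure (Ω × ℝ) :=
  B₀.prod ((μ.restrict (Ioc 0 1)).withDensity fun p => ENNReal.ofReal p⁻¹)

/-- The data of a conditionally i.i.d. sequence of Bernoulli processes directed by
`B = ∑_{k < N} b_k δ_{ω_k}`, where `X k = (ω_k, b_k)`: the pairs `(ω_k, b_k)` are the points of a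
Poisson process with intensity `ν`, and the `U j k` are i.i.d. uniform on `(0, 1)`, independent of
these points. -/
structure IsBernoulliSampling {Ξ Ω : Type*} [MeasurableSpace Ξ] [MeasurableSpace Ω]
    (P : Measure Ξ) (N : Ξ → ℕ∞) (X : ℕ → Ξ → Ω × ℝ) (U : ℕ → ℕ → Ξ → ℝ)
    (ν : Measure (Ω × ℝ)) : Prop where
  poisson : IsPoissonProcess P N X ν
  measurable_uniform : ∀ j k, Measurable (U j k)
  uniform : ∀ j k, P.map (U j k) = (volume : Measure ℝ).restrict (Ioo 0 1)
  indep_uniform : iIndepFun (fun q : ℕ × ℕ => U q.1 q.2) P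
  indep_points : IndepFun (fun ξ => (N ξ, fun k => X k ξ)) (fun ξ (q : ℕ × ℕ) => U q.1 q.2 ξ) P

open Classical in
/-- The Bernoulli process `Z_j = ∑_{k < N} 1{U_{j,k} < b_k} δ_{ω_k}`, where `X k = (ω_k, b_k)`. -/
def bernoulliProcess {Ξ Ω : Type*} [MeasurableSpace Ω] (N : Ξ → ℕ∞) (X : ℕ → Ξ → Ω × ℝ)
    (U : ℕ → ℕ → Ξ → ℝ) (j : ℕ) (ξ : Ξ) : Measure Ω :=
  Measure.sum fun k : ℕ =>
    if (k : ℕ∞) < N ξ ∧ U j k ξ < (X k ξ).2 then Measure.dirac (X k ξ).1 else 0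

/-- The set of distinct atoms among the measures `z_1, …, z_n`. -/
def atoms {Ω : Type*} [MeasurableSpace Ω] {n : ℕ} (z : Fin n → Measure Ω) : Set Ω :=
  {ω | ∃ j, z j {ω} ≠ 0}

/-- The number `S(ω) = ∑_j z_j {ω}` of the measures `z_1, …, z_n` that have the atom `ω`. -/
def atomCount {Ω : Type*} [MeasurableSpace Ω] {n : ℕ} (z : Fin n → Measure Ω) (ω : Ω) : ℕ :=
  ⌊∑ j, (z j).real {ω}⌋₊

/-- The product formula
`γ ^ K exp (-γ ∑_{j=1}^n Φ_{j-1}^{1,1}) ∏_{k=1}^K (1 - α)_{S_k - 1} Φ_{n - S_k}^{S_k, 1}`,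
where `K` is the number of distinct atoms among `z_1, …, z_n` and `S_k` is the number of these
measures that have the `k`-th atom. -/
def productDensity {Ω : Type*} [MeasurableSpace Ω] (α : ℝ) (V : ℕ → ℕ → ℝ) (γ : ℝ) {n : ℕ}
    (z : Fin n → Measure Ω) : ℝ :=
  γ ^ (atoms z).ncard *
    Real.exp (-γ * ∑ j ∈ Finset.Icc 1 n, primitive α V (j - 1) 1 1) *
    ∏ᶠ ω ∈ atoms z, rising (1 - α) (atomCount z ω - 1) *
      primitive α V (n - atomCount z ω) (atomCount z ω) 1

open Classical in
/-- The configuration `(z_1, …, z_n)` in which the atom `x k` belongs to exactly the `z_j` with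
`j ∈ h k`, that is `z_j = ∑_{k : j ∈ h k} δ_{x k}`. -/
def configuration {Ω : Type*} [MeasurableSpace Ω] {n K : ℕ}
    (h : Fin K → {s : Finset (Fin n) // s.Nonempty}) (x : Fin K → Ω) (j : Fin n) : Measure Ω :=
  ∑ k, if j ∈ (h k).1 then Measure.dirac (x k) else 0

/-- The law of an `n`-tuple of measures having "density" `p(z_1, …, z_n) ∏_k Q(dω_k)`, where
`{ω_1, …, ω_K}` is the unordered set of distinct atoms: sum over the number `K` of atoms and the
nonempty sets `h k` of the indices `j` for which `z_j` has the `k`-th atom, integrate over the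
positions of the labelled atoms, and divide by the number `K!` of labellings. -/
def lawOfDensity {Ω : Type*} [MeasurableSpace Ω] (Q : Measure Ω) {n : ℕ}
    (p : (Fin n → Measure Ω) → ℝ) : Measure (Fin n → Measure Ω) :=
  Measure.sum fun K : ℕ => (K ! : ℝ≥0∞)⁻¹ •
    Measure.sum fun h : Fin K → {s : Finset (Fin n) // s.Nonempty} =>
      ((Measure.pi fun _ : Fin K => Q).withDensity
        fun x => ENNReal.ofReal (p (configuration h x))).map (configuration h)

end GibbsIBP

end

noncomputable section

namespace GibbsIBP

/-! Both laws in the theorem have explicit Laplace functionals, and these agree. The combinatorial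
input is the moment formula E[P₁^a (1 - P₁)^b] = (1 - α)_a Φ_b^{a+1,1}
(`IsGibbsPartition.integral_firstFreq`). The right side is the probability that a given integers
join the block of the first one and b others do not: sum the Gibbs probabilities over all partitions
of the b others, where 𝒞(b, k; α) / α^k is the weighted number of partitions into k blocks. This
probability depends only on a and b, so the membership indicators are exchangeable. Their averages
converge to P₁, and the weights are the mixed moments of P₁. For the process, integrating out the
uniforms and applying the Poisson Laplace functional gives E exp(-∑_j ∫ f_j dZ_j) = exp(-I), where I
is the integral of 1 - ∏_j (1 - p + p e^{-f_j(ω)}) against B₀(dω) p⁻¹ μ₁(dp). Expand the product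
over the set H of successful trials. For H ≠ ∅ the factor p^{|H|} absorbs p⁻¹, and the moment
formula gives the weight w_H = (1 - α)_{|H|-1} Φ_{n-|H|}^{|H|,1}. The rest is 1 - (1 - p)^n, whose
quotient by p is ∑_{j<n} (1 - p)^j, with mean ∑_j Φ_{j-1}^{1,1}. Hence I = γ ∑_j Φ_{j-1}^{1,1} - S
with S = ∑_H w_H ∫ ∏_{j∈H} e^{-f_j} dB₀. Under the product density the atoms are almost surely
distinct, so the functional factors over labelled atoms, and summing over K and the sets h_k gives
the exponential series exp(-γ ∑_j Φ_{j-1}^{1,1}) exp(S). The Laplace functional determines the law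
of a tuple of random measures (`ext_of_lintegral_lap_measures`). -/

/-! ### Rising factorials and recursions for the generalized factorial coefficients. -/

@[simp]
theorem rising_zero (a : ℝ) : rising a 0 = 1 := by simp [rising]

theorem rising_succ (a : ℝ) (n : ℕ) : rising a (n + 1) = rising a n * (a + n) := by
  simp [rising, ascPochhammer_succ_right]

theorem rising_succ_left (a : ℝ) (n : ℕ) : rising a (n + 1) = a * rising (a + 1) n := by
  simp [rising, ascPochhammer_succ_left]

theorem rising_nonneg {a : ℝ} (ha : 0 ≤ a) (n : ℕ) : 0 ≤ rising a n := by
  induction n with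
  | zero => simp
  | succ n ih => rw [rising_succ]; positivity

/-- Chu–Vandermonde for rising factorials, by induction: Pascal's rule matches the splitting a + b +
n = (a + j) + (b + n - j) of the new factor. -/
theorem rising_add (a b : ℝ) (n : ℕ) :
    rising (a + b) n =
      ∑ j ∈ Finset.range (n + 1), (n.choose j : ℝ) * (rising a j * rising b (n - j)) := by
  induction n with
  | zero => simp
  | succ n ih =>
    rw [Finset.sum_range_succ_comm]
    have h1 : ∀ j ∈ Finset.range (n + 1),
        ((n + 1).choose j : ℝ) * (rising a j * rising b (n + 1 - j)) =
          (n.choose j : ℝ) * (rising a j * rising b (n - j)) * (b + (n - j : ℕ)) +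
          ((n + 1).choose j - n.choose j : ℝ) * (rising a j * rising b (n + 1 - j)) := by
      intro j hj
      have : n + 1 - j = n - j + 1 := by have := Finset.mem_range.1 hj; omega
      rw [this, rising_succ]; ring
    rw [Finset.sum_congr rfl h1, Finset.sum_add_distrib, Finset.sum_range_succ' (fun j : ℕ =>
      ((n + 1).choose j - n.choose j : ℝ) * (rising a j * rising b (n + 1 - j)))]
    have h2 : ∀ j ∈ Finset.range n,
        (((n + 1).choose (j + 1) : ℝ) - n.choose (j + 1)) *
            (rising a (j + 1) * rising b (n + 1 - (j + 1))) =
          (n.choose j : ℝ) * (rising a j * rising b (n - j)) * (a + j) := by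
      intro j hj
      rw [Nat.choose_succ_succ, rising_succ, Nat.add_sub_add_right]; push_cast; ring
    rw [Finset.sum_congr rfl h2, rising_succ, ih]
    have h3 : ((n + 1).choose (n + 1) : ℝ) * (rising a (n + 1) * rising b (n + 1 - (n + 1))) =
        (n.choose n : ℝ) * (rising a n * rising b (n - n)) * (a + n) := by
      simp [rising_succ]
    rw [h3]
    have h4 := Finset.sum_range_succ
      (fun j : ℕ => (n.choose j : ℝ) * (rising a j * rising b (n - j)) * (a + j)) n
    have h5 : (∑ j ∈ Finset.range (n + 1), (n.choose j : ℝ) * (rising a j * rising b (n - j))) *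
        (a + b + n) = ∑ j ∈ Finset.range (n + 1),
          (n.choose j : ℝ) * (rising a j * rising b (n - j)) * (a + j) +
        ∑ j ∈ Finset.range (n + 1),
          (n.choose j : ℝ) * (rising a j * rising b (n - j)) * (b + (n - j : ℕ)) := by
      rw [Finset.sum_mul, ← Finset.sum_add_distrib]
      refine Finset.sum_congr rfl fun j hj => ?_
      rw [Nat.cast_sub (by have := Finset.mem_range.1 hj; omega)]; ring
    rw [h5, h4]; simp; ring

theorem rising_zero_left_succ (n : ℕ) : rising 0 (n + 1) = 0 := by simp [rising_succ_left]

theorem rising_one (n : ℕ) : rising 1 n = n ! := by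
  induction n with
  | zero => simp
  | succ n ih => rw [rising_succ, ih, Nat.factorial_succ]; push_cast; ring

/-- This is the recursion for weighted set partitions: j is the number of companions of a
distinguished element. Algebraically, `rising_add` collapses the sum over j, and the rest is
(-(i+1)α)_{m+1} = -(i+1)α (1 - (i+1)α)_m together with (i+1) C(k+1, i+1) = (k+1) C(k, i). -/
theorem genFactCoeff_succ_succ (m k : ℕ) (α : ℝ) :
    genFactCoeff (m + 1) (k + 1) α =
      α * ∑ j ∈ Finset.range (m + 1),
        (m.choose j : ℝ) * rising (1 - α) j * genFactCoeff (m - j) k α := by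
  have h1 : ∑ j ∈ Finset.range (m + 1),
        (m.choose j : ℝ) * rising (1 - α) j * genFactCoeff (m - j) k α =
      1 / (k ! : ℝ) * ∑ i ∈ Finset.range (k + 1),
        (-1 : ℝ) ^ i * (k.choose i : ℝ) * rising (1 - α + -((i : ℝ) * α)) m := by
    simp_rw [genFactCoeff, rising_add, Finset.mul_sum]
    rw [Finset.sum_comm]
    refine Finset.sum_congr rfl fun i _ => Finset.sum_congr rfl fun j _ => by ring
  rw [h1, genFactCoeff, Finset.sum_range_succ']
  have h0 : rising (-(((0 : ℕ) : ℝ) * α)) (m + 1) = 0 := by simp [rising_zero_left_succ]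
  rw [h0, mul_zero, add_zero, Finset.mul_sum, Finset.mul_sum, Finset.mul_sum]
  refine Finset.sum_congr rfl fun i _ => ?_
  have h2 : ((k + 1).choose (i + 1) : ℝ) * (i + 1) = (k + 1) * k.choose i := by
    exact_mod_cast (Nat.add_one_mul_choose_eq k i).symm
  have h3 : (1 - α + -((i : ℝ) * α)) = -(((i + 1 : ℕ) : ℝ) * α) + 1 := by push_cast; ring
  have hk : ((k + 1 : ℕ) : ℝ) ≠ 0 := by positivity
  have hk' : (k ! : ℝ) ≠ 0 := by positivity
  rw [rising_succ_left, h3, Nat.factorial_succ]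
  generalize rising (-(((i + 1 : ℕ) : ℝ) * α) + 1) m = r
  push_cast at hk ⊢
  field_simp
  linear_combination (-1 : ℝ) ^ i * r * α * h2

/-- The case α = 0 of the same recursion, where (1)_j = j!. It comes from unrolling the two-term
Stirling recursion in m. -/
theorem stirlingFirst_succ_succ_eq_sum (m k : ℕ) :
    ((m + 1).stirlingFirst (k + 1) : ℝ) =
      ∑ j ∈ Finset.range (m + 1), (m.choose j : ℝ) * j ! * ((m - j).stirlingFirst k : ℝ) := by
  have key : ∀ m : ℕ, ((m + 1).stirlingFirst (k + 1) : ℝ) =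
      ∑ i ∈ Finset.range (m + 1), (m ! : ℝ) / i ! * (i.stirlingFirst k : ℝ) := by
    intro m
    induction m with
    | zero => simp [Nat.stirlingFirst_succ_succ]
    | succ m ih =>
      rw [Nat.stirlingFirst_succ_succ, Finset.sum_range_succ]
      push_cast
      rw [ih, div_self (by positivity), one_mul, Finset.mul_sum]
      congr 1
      refine Finset.sum_congr rfl fun i _ => ?_
      rw [Nat.factorial_succ]; push_cast; ring
  rw [key, ← Finset.sum_range_reflect]
  refine Finset.sum_congr rfl fun j hj => ?_
  have hj : j ≤ m := by have := Finset.mem_range.1 hj; omega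
  rw [show m + 1 - 1 - j = m - j by omega, Nat.cast_choose ℝ hj]
  field_simp

section genFactRatio

variable (α : ℝ)

@[simp]
theorem genFactRatio_zero_zero : genFactRatio 0 0 α = 1 := by
  by_cases h : α = 0 <;> simp [genFactRatio, h, genFactCoeff]

@[simp]
theorem genFactRatio_zero_succ (k : ℕ) : genFactRatio 0 (k + 1) α = 0 := by
  by_cases h : α = 0
  · simp [genFactRatio, h]
  · have := Int.alternating_sum_range_choose_of_ne (Nat.succ_ne_zero k)
    have h2 : ∑ i ∈ Finset.range (k + 1 + 1), (-1 : ℝ) ^ i * ((k + 1).choose i : ℝ) = 0 := by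
      exact_mod_cast this
    simp [genFactRatio, h, genFactCoeff, h2]

@[simp]
theorem genFactRatio_succ_zero (m : ℕ) : genFactRatio (m + 1) 0 α = 0 := by
  by_cases h : α = 0
  · simp [genFactRatio, h]
  · simp [genFactRatio, h, genFactCoeff, rising_zero_left_succ]

/-- Division by α^{k+1} absorbs the stray factor α, so one recursion covers α = 0 and α ≠ 0, and the
case distinction ends here. -/
theorem genFactRatio_succ_succ (m k : ℕ) :
    genFactRatio (m + 1) (k + 1) α =
      ∑ j ∈ Finset.range (m + 1),
        (m.choose j : ℝ) * (rising (1 - α) j * genFactRatio (m - j) k α) := by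
  by_cases h : α = 0
  · subst h
    simp only [genFactRatio, if_true, sub_zero, rising_one]
    rw [stirlingFirst_succ_succ_eq_sum]
    exact Finset.sum_congr rfl fun j _ => by ring
  · simp only [genFactRatio, h, if_false]
    rw [genFactCoeff_succ_succ, pow_succ', mul_div_mul_left _ _ h, Finset.sum_div]
    exact Finset.sum_congr rfl fun j _ => by ring

end genFactRatio

/-! ### Weighted enumeration of set partitions. -/

section Finpartition

variable {τ : Type*} [DecidableEq τ]

/-- Sums over the partitions of `s`, split according to the block of `a ∈ s`. -/
theorem sum_finpartition_eq_sum_block {M : Type*} [AddCommMonoid M] {s : Finset τ} {a : τ}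
    (ha : a ∈ s) (H : Finset (Finset τ) → M) :
    ∑ π : Finpartition s, H π.parts =
      ∑ A ∈ s.powerset with a ∈ A, ∑ σ : Finpartition (s \ A), H (insert A σ.parts) := by
  have hnot : ∀ {A : Finset τ}, a ∈ A → ∀ σ : Finpartition (s \ A), ∀ C ∈ σ.parts, a ∉ C := by
    intro A hA σ C hC haC
    exact (Finset.mem_sdiff.1 (σ.le hC haC)).2 hA
  rw [Finset.sum_sigma']
  symm
  refine Finset.sum_bij (fun q hq => q.2.extend (b := q.1) (c := s) ?_ ?_ ?_) ?_ ?_ ?_ ?_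
  · have := (Finset.mem_filter.1 (Finset.mem_sigma.1 hq).1).2
    exact Finset.ne_empty_of_mem this
  · exact Finset.sdiff_disjoint
  · have := (Finset.mem_powerset.1 (Finset.mem_filter.1 (Finset.mem_sigma.1 hq).1).1)
    exact Finset.sdiff_union_of_subset this
  · simp
  · rintro ⟨A, σ⟩ hA ⟨B, ρ⟩ hB h
    simp only [Finset.mem_sigma, Finset.mem_filter, Finset.mem_powerset, Finset.mem_univ,
      and_true] at hA hB
    have h' : insert A σ.parts = insert B ρ.parts := congrArg Finpartition.parts h
    have hAB : A = B := by
      have : A ∈ insert B ρ.parts := h' ▸ Finset.mem_insert_self _ _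
      rcases Finset.mem_insert.1 this with h1 | h1
      · exact h1
      · exact absurd hA.2 (hnot hB.2 ρ A h1)
    subst hAB
    have hA1 : A ∉ σ.parts := fun hh => hnot hA.2 σ A hh hA.2
    have hA2 : A ∉ ρ.parts := fun hh => hnot hA.2 ρ A hh hA.2
    have : σ = ρ := by
      ext1
      rw [← Finset.erase_insert hA1, h', Finset.erase_insert hA2]
    rw [this]
  · intro π _
    have hmem : π.part a ∈ π.parts := π.part_mem.2 ha
    refine ⟨⟨π.part a, π.ofSubset (b := s \ π.part a) (Finset.erase_subset (π.part a) _) ?_⟩,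
      ?_, ?_⟩
    · have h1 := π.sup_parts
      rw [← Finset.insert_erase hmem, Finset.sup_insert] at h1
      have h2 : Disjoint (π.part a) ((π.parts.erase (π.part a)).sup id) := by
        rw [Finset.disjoint_sup_right]
        intro C hC
        exact π.disjoint hmem (Finset.mem_of_mem_erase hC) (Finset.ne_of_mem_erase hC).symm
      have h3 : ∀ B C D : Finset τ, B ∪ C = D → Disjoint B C → C = D \ B := by
        rintro B C D rfl hBC
        rw [Finset.union_sdiff_left, Finset.sdiff_eq_self_of_disjoint hBC.symm]
      exact h3 _ _ _ h1 h2
    · simp [π.part_subset a, π.mem_part_self.2 ha]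
    · ext1
      simp [Finpartition.extend, Finpartition.ofSubset, Finset.insert_erase hmem]
  · rintro ⟨A, σ⟩ _
    rfl

theorem sum_powerset_filter_mem {M : Type*} [AddCommMonoid M] {s : Finset τ} {a : τ}
    (ha : a ∈ s) (f : ℕ → M) :
    ∑ A ∈ s.powerset with a ∈ A, f A.card =
      ∑ j ∈ Finset.range s.card, (s.card - 1).choose j • f (j + 1) := by
  have h1 : ∑ A ∈ s.powerset with a ∈ A, f A.card =
      ∑ B ∈ (s.erase a).powerset, f (B.card + 1) := by
    symm
    refine Finset.sum_bij' (fun B _ => insert a B) (fun A _ => A.erase a) ?_ ?_ ?_ ?_ ?_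
    · intro B hB
      rw [Finset.mem_powerset, Finset.subset_erase] at hB
      simp [Finset.insert_subset_iff, ha, hB.1]
    · intro A hA
      simp only [Finset.mem_filter, Finset.mem_powerset] at hA ⊢
      exact Finset.erase_subset_erase _ hA.1
    · intro B hB
      rw [Finset.mem_powerset, Finset.subset_erase] at hB
      exact Finset.erase_insert hB.2
    · intro A hA
      exact Finset.insert_erase (Finset.mem_filter.1 hA).2
    · intro B hB
      rw [Finset.mem_powerset, Finset.subset_erase] at hB
      rw [Finset.card_insert_of_notMem hB.2]
  rw [h1, Finset.sum_powerset_apply_card (fun j => f (j + 1)), Finset.card_erase_of_mem ha,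
    Nat.sub_add_cancel (Finset.card_pos.2 ⟨a, ha⟩)]

/-- The weighted number of partitions of `s` into `k` blocks, a block of size `j` having weight
`(1 - α)_{j - 1}`, is `𝒞(|s|, k; α) / α ^ k`. -/
theorem sum_finpartition_prod_rising (α : ℝ) (s : Finset τ) (M : ℕ) (hM : s.card ≤ M)
    (w : ℕ → ℝ) :
    ∑ π : Finpartition s, w π.parts.card * ∏ A ∈ π.parts, rising (1 - α) (A.card - 1) =
      ∑ k ∈ Finset.range (M + 1), w k * genFactRatio s.card k α := by
  -- Remove the block of a fixed element. Its removal shifts `w` by one, and the remainders `s \ A`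
  -- have different sizes; a common bound `M` on the number of blocks lets the sums over A and k be
  -- exchanged.
  induction s using Finset.strongInduction generalizing M w with
  | H s ih =>
    rcases s.eq_empty_or_nonempty with rfl | ⟨a, ha⟩
    · rw [Finset.sum_range_succ']
      rw [Finset.sum_eq_zero (s := Finset.range M) (fun k _ => by simp)]
      have : ∀ π : Finpartition (∅ : Finset τ), π.parts = ∅ := fun π => by
        rw [Finpartition.parts_eq_empty_iff]; rfl
      have hc : Fintype.card (Finpartition (∅ : Finset τ)) = 1 :=
        Fintype.card_eq_one_iff.2 ⟨Finpartition.empty _, fun π => by ext1; rw [this, this]⟩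
      simp [this, hc, Finset.card_univ]
    · obtain ⟨m, hm⟩ : ∃ m, s.card = m + 1 := ⟨s.card - 1, by
        have := Finset.card_pos.2 ⟨a, ha⟩; omega⟩
      obtain ⟨M, rfl⟩ : ∃ M', M = M' + 1 := ⟨M - 1, by omega⟩
      rw [sum_finpartition_eq_sum_block ha
        (fun P => w P.card * ∏ A ∈ P, rising (1 - α) (A.card - 1))]
      have hstep : ∀ A ∈ s.powerset.filter (a ∈ ·),
          ∑ σ : Finpartition (s \ A), w (insert A σ.parts).card *
            ∏ C ∈ insert A σ.parts, rising (1 - α) (C.card - 1) =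
          (fun j => rising (1 - α) (j - 1) * ∑ k ∈ Finset.range (M + 1),
            w (k + 1) * genFactRatio (s.card - j) k α) A.card := by
        intro A hA
        simp only [Finset.mem_filter, Finset.mem_powerset] at hA
        have hcard : (s \ A).card = s.card - A.card := Finset.card_sdiff_of_subset hA.1
        have hpos : 0 < A.card := Finset.card_pos.2 ⟨a, hA.2⟩
        have := ih (s \ A) (Finset.sdiff_ssubset hA.1 ⟨a, hA.2⟩) M (by omega) (fun k => w (k + 1))
        simp only
        rw [← hcard, ← this, Finset.mul_sum]
        refine Finset.sum_congr rfl fun σ _ => ?_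
        have hn : A ∉ σ.parts := fun hh =>
          (Finset.mem_sdiff.1 (σ.le hh hA.2)).2 hA.2
        rw [Finset.card_insert_of_notMem hn, Finset.prod_insert hn]
        ring
      rw [Finset.sum_congr rfl hstep]
      refine (sum_powerset_filter_mem ha (fun j => rising (1 - α) (j - 1) *
        ∑ k ∈ Finset.range (M + 1), w (k + 1) * genFactRatio (s.card - j) k α)).trans ?_
      rw [Finset.sum_range_succ' _ (M + 1), hm, genFactRatio_succ_zero, mul_zero, add_zero]
      simp_rw [genFactRatio_succ_succ, Finset.mul_sum, nsmul_eq_mul, Finset.mul_sum]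
      rw [Finset.sum_comm]
      refine Finset.sum_congr rfl fun k _ => Finset.sum_congr rfl fun j _ => ?_
      simp only [Nat.add_sub_cancel, Nat.add_sub_add_right]
      ring

/-- Partitions of s having A as a block are partitions of `s \ A`. In the decomposition by the block
of a, only the term A survives. -/
theorem sum_finpartition_mem_parts (α : ℝ) {s A : Finset τ} {a : τ} (ha : a ∈ A) (hA : A ⊆ s)
    (w : ℕ → ℝ) :
    ∑ π : Finpartition s with A ∈ π.parts,
        w π.parts.card * ∏ C ∈ π.parts, rising (1 - α) (C.card - 1) =
      rising (1 - α) (A.card - 1) *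
        ∑ k ∈ Finset.range (s.card - A.card + 1),
          w (k + 1) * genFactRatio (s.card - A.card) k α := by
  rw [Finset.sum_filter, sum_finpartition_eq_sum_block (hA ha)
    (fun P => if A ∈ P then w P.card * ∏ C ∈ P, rising (1 - α) (C.card - 1) else 0)]
  have hnot : ∀ {B : Finset τ}, a ∈ B → ∀ σ : Finpartition (s \ B), ∀ C ∈ σ.parts, a ∉ C := by
    intro B hB σ C hC haC
    exact (Finset.mem_sdiff.1 (σ.le hC haC)).2 hB
  rw [Finset.sum_eq_single_of_mem A (by simp [ha, hA])]
  · have hcard : (s \ A).card = s.card - A.card := Finset.card_sdiff_of_subset hA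
    rw [← hcard, ← sum_finpartition_prod_rising α (s \ A) _ le_rfl (fun k => w (k + 1)),
      Finset.mul_sum]
    refine Finset.sum_congr rfl fun σ _ => ?_
    have hn : A ∉ σ.parts := fun hh => hnot ha σ A hh ha
    rw [if_pos (Finset.mem_insert_self _ _), Finset.card_insert_of_notMem hn,
      Finset.prod_insert hn]
    ring
  · intro B hB hBA
    refine Finset.sum_eq_zero fun σ _ => if_neg fun hmem => ?_
    rcases Finset.mem_insert.1 hmem with h1 | h1
    · exact hBA h1.symm
    · exact hnot (Finset.mem_filter.1 hB).2 σ A h1 ha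

end Finpartition

/-- Starting the sum at k = 0 makes the convention for Φ_0 part of the general formula, since the
ratio at k = 0 is 1 for m = 0 and 0 for m ≥ 1. -/
theorem primitive_eq_sum_range (α : ℝ) (V : ℕ → ℕ → ℝ) (m z : ℕ) :
    primitive α V m z 1 =
      ∑ k ∈ Finset.range (m + 1), V (m + z) (k + 1) * genFactRatio m k α := by
  rcases m with _ | m
  · simp [primitive]
  · rw [primitive, if_neg (Nat.succ_ne_zero m), Finset.sum_range_succ', genFactRatio_succ_zero,
      mul_zero, add_zero, Finset.range_eq_Ico, Finset.sum_Ico_add' (fun k =>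
        V (m + 1 + z) (k + 1) * genFactRatio (m + 1) k α) 0 (m + 1) 1]
    rfl

/-! ### Exchangeability of membership in the first block. -/

section BlockEvent

variable {Ξ : Type*}

/-- The integers represented by the elements of `A` are in the first block, those represented by the
elements of `B` are not. -/
def blockEvent (R : Ξ → Setoid ℕ) (A B : Finset ℕ) : Set Ξ :=
  {ξ | (∀ j ∈ A, R ξ 0 j) ∧ ∀ j ∈ B, ¬ R ξ 0 j}

/-- The probability that `a` given integers are in the first block and `b` given integers are not:
`(1 - α)_a Φ_b^{a + 1, 1}`. -/
def blockWeight (α : ℝ) (V : ℕ → ℕ → ℝ) (a b : ℕ) : ℝ :=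
  rising (1 - α) a * primitive α V b (a + 1) 1

variable [MeasurableSpace Ξ] {P : Measure Ξ} {R : Ξ → Setoid ℕ} {α : ℝ} {V : ℕ → ℕ → ℝ}

theorem IsGibbsPartition.measurableSet_blockEvent (hR : IsGibbsPartition P R α V)
    (A B : Finset ℕ) : MeasurableSet (blockEvent R A B) := by
  simp only [blockEvent, ofPred_and, ofPred_forall]
  exact (Finset.measurableSet_biInter _ fun j _ => hR.measurable 0 j).inter
    (Finset.measurableSet_biInter _ fun j _ => (hR.measurable 0 j).compl)

/-- Once membership is decided for all of an initial segment, the event is a disjoint union of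
events of prescribed restriction, over the partitions in which `A` together with 0 is a block. The
Gibbs probabilities of these are summed by `sum_finpartition_mem_parts`. -/
theorem IsGibbsPartition.measureReal_blockEvent_of_union_eq [IsProbabilityMeasure P]
    (hR : IsGibbsPartition P R α V) {m : ℕ} {A B : Finset ℕ} (hd : Disjoint A B)
    (hAB : A ∪ B = Finset.Icc 1 m) :
    P.real (blockEvent R A B) = blockWeight α V A.card B.card := by
  classical
  have hA1 : ∀ j ∈ A, 1 ≤ j ∧ j ≤ m := fun j hj =>
    Finset.mem_Icc.1 (hAB ▸ Finset.mem_union_left _ hj)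
  have hB1 : ∀ j ∈ B, 1 ≤ j ∧ j ≤ m := fun j hj =>
    Finset.mem_Icc.1 (hAB ▸ Finset.mem_union_right _ hj)
  have hcard : A.card + B.card = m := by
    rw [← Finset.card_union_of_disjoint hd, hAB]; simp
  set A' : Finset (Fin (m + 1)) := Finset.univ.filter fun j => (j : ℕ) ∈ insert 0 A with hA'
  have hA'c : A'.card = A.card + 1 := by
    have h0 : 0 ∉ A := fun h => by have := hA1 0 h; omega
    rw [← Finset.card_insert_of_notMem h0, ← Finset.card_map Fin.valEmbedding (s := A')]
    congr 1
    ext j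
    simp only [hA', Finset.mem_map, Finset.mem_filter, Finset.mem_univ, true_and,
      Fin.valEmbedding_apply]
    constructor
    · rintro ⟨i, hi, rfl⟩; exact hi
    · intro hj
      have : j < m + 1 := by
        rcases Finset.mem_insert.1 hj with rfl | h
        · omega
        · have := hA1 j h; omega
      exact ⟨⟨j, this⟩, hj, rfl⟩
  set G : Finpartition (Finset.univ : Finset (Fin (m + 1))) → Set Ξ := fun π =>
    {ξ | ∀ i j : Fin (m + 1), R ξ i j ↔ j ∈ π.part i} with hG
  have hGm : ∀ π, MeasurableSet (G π) := by
    intro π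
    simp only [hG, ofPred_forall]
    refine MeasurableSet.iInter fun i => MeasurableSet.iInter fun j => ?_
    by_cases h : j ∈ π.part i
    · simpa [h] using hR.measurable i j
    · simp only [h, iff_false]; exact (hR.measurable i j).compl
  have hGd : ∀ π ρ, π ≠ ρ → Disjoint (G π) (G ρ) := by
    intro π ρ hne
    rw [Set.disjoint_left]
    intro ξ h1 h2
    apply hne
    have h3 : ∀ i, π.part i = ρ.part i := fun i => by
      ext j; rw [← h1 i j, h2 i j]
    ext C
    constructor
    · intro hC
      obtain ⟨x, hx⟩ := π.nonempty_of_mem_parts hC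
      rw [← π.part_eq_of_mem hC hx, h3]
      exact ρ.part_mem.2 (Finset.mem_univ _)
    · intro hC
      obtain ⟨x, hx⟩ := ρ.nonempty_of_mem_parts hC
      rw [← ρ.part_eq_of_mem hC hx, ← h3]
      exact π.part_mem.2 (Finset.mem_univ _)
  have h0A' : (0 : Fin (m + 1)) ∈ A' := by simp [hA']
  have hEq : blockEvent R A B =
      ⋃ π ∈ Finset.univ.filter (fun π : Finpartition (Finset.univ : Finset (Fin (m + 1))) =>
        A' ∈ π.parts), G π := by
    ext ξ
    simp only [mem_iUnion, Finset.mem_filter, Finset.mem_univ, true_and, exists_prop]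
    constructor
    · intro hξ
      let s : Setoid (Fin (m + 1)) := (R ξ).comap (fun i : Fin (m + 1) => (i : ℕ))
      have hpart : ∀ i j, j ∈ (Finpartition.ofSetoid s).part i ↔ R ξ i j := fun i j =>
        Finpartition.mem_part_ofSetoid_iff_rel
      refine ⟨Finpartition.ofSetoid s, ?_, fun i j => (hpart i j).symm⟩
      have : A' = (Finpartition.ofSetoid s).part 0 := by
        ext j
        rw [hpart]
        simp only [hA', Finset.mem_filter, Finset.mem_univ, true_and, Finset.mem_insert]
        constructor
        · rintro (h | h)
          · rw [h]; exact (R ξ).refl' 0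
          · exact hξ.1 _ h
        · intro h
          by_contra hcon
          push Not at hcon
          have hjm : (j : ℕ) ∈ A ∪ B := by
            rw [hAB, Finset.mem_Icc]; have := j.2; omega
          rcases Finset.mem_union.1 hjm with h' | h'
          · exact hcon.2 h'
          · exact hξ.2 _ h' h
      rw [this]
      exact (Finpartition.part_mem _).2 (Finset.mem_univ _)
    · rintro ⟨π, hπ, hξ⟩
      have hp : π.part 0 = A' := π.part_eq_of_mem hπ h0A'
      have key : ∀ j, (hj : j < m + 1) → (R ξ 0 j ↔ j ∈ insert 0 A) := fun j hj => by
        have := hξ 0 ⟨j, hj⟩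
        rw [hp] at this
        simpa [hA'] using this
      refine ⟨fun j hj => ?_, fun j hj => ?_⟩
      · exact (key j (by have := hA1 j hj; omega)).2 (Finset.mem_insert_of_mem hj)
      · rw [key j (by have := hB1 j hj; omega), Finset.mem_insert]
        rintro (h | h)
        · have := hB1 j hj; omega
        · exact Finset.disjoint_left.1 hd h hj
  have hval : ∀ π, P.real (G π) =
      V (m + 1) π.parts.card * ∏ C ∈ π.parts, rising (1 - α) (C.card - 1) := by
    intro π
    rw [measureReal_def, hG, hR.eppf (m + 1) (by omega) π, ENNReal.toReal_ofReal]
    refine mul_nonneg (hR.weights.nonneg _ _ ?_ ?_) (Finset.prod_nonneg fun C _ =>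
      rising_nonneg (by linarith [hR.weights.discount_lt_one]) _)
    · exact Finset.card_pos.2 (π.parts_nonempty (Finset.univ_nonempty.ne_empty))
    · simpa using π.card_parts_le_card
  rw [hEq, measureReal_biUnion_finset (fun π _ ρ _ h => hGd π ρ h) (fun π _ => hGm π)]
  simp_rw [hval]
  rw [sum_finpartition_mem_parts α h0A' (Finset.subset_univ _), hA'c, blockWeight,
    primitive_eq_sum_range, Finset.card_univ, Fintype.card_fin]
  have e1 : m + 1 - (A.card + 1) = B.card := by omega
  have e2 : B.card + (A.card + 1) = m + 1 := by omega
  rw [e1, e2, Nat.add_sub_cancel]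

theorem IsGibbsPartition.measureReal_blockEvent_insert [IsProbabilityMeasure P]
    (hR : IsGibbsPartition P R α V) (A B : Finset ℕ) (x : ℕ) :
    P.real (blockEvent R A B) =
      P.real (blockEvent R (insert x A) B) + P.real (blockEvent R A (insert x B)) := by
  rw [← measureReal_inter_add_sdiff (μ := P) (s := blockEvent R A B) (hR.measurable 0 x)]
  congr 2
  · ext ξ; simp only [blockEvent, mem_inter_iff, mem_ofPred_eq, Finset.forall_mem_insert]; tauto
  · ext ξ; simp only [blockEvent, Set.mem_sdiff, mem_ofPred_eq, Finset.forall_mem_insert]; tauto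

/-- Additivity of `P`: the integer a + b + 1 either joins the first block or does not, and all three
events decide membership on an initial segment. -/
theorem IsGibbsPartition.blockWeight_eq_add [IsProbabilityMeasure P]
    (hR : IsGibbsPartition P R α V) (a b : ℕ) :
    blockWeight α V a b = blockWeight α V (a + 1) b + blockWeight α V a (b + 1) := by
  have hd : Disjoint (Finset.Icc 1 a) (Finset.Ioc a (a + b)) := by
    rw [Finset.disjoint_left]; intro j; simp; omega
  have hu : Finset.Icc 1 a ∪ Finset.Ioc a (a + b) = Finset.Icc 1 (a + b) := by
    ext j; simp; omega
  have h1 : a + b + 1 ∉ Finset.Icc 1 a := by simp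
  have h2 : a + b + 1 ∉ Finset.Ioc a (a + b) := by simp
  have hu' : insert (a + b + 1) (Finset.Icc 1 (a + b)) = Finset.Icc 1 (a + b + 1) := by
    ext j; simp; omega
  have e0 := hR.measureReal_blockEvent_of_union_eq hd hu
  have e1 := hR.measureReal_blockEvent_of_union_eq (A := insert (a + b + 1) (Finset.Icc 1 a))
    (B := Finset.Ioc a (a + b)) (m := a + b + 1) (Finset.disjoint_insert_left.2 ⟨h2, hd⟩)
    (by rw [Finset.insert_union, hu, hu'])
  have e2 := hR.measureReal_blockEvent_of_union_eq (A := Finset.Icc 1 a)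
    (B := insert (a + b + 1) (Finset.Ioc a (a + b))) (m := a + b + 1)
    (Finset.disjoint_insert_right.2 ⟨h1, hd⟩) (by rw [Finset.union_insert, hu, hu'])
  rw [Finset.card_insert_of_notMem h1] at e1
  rw [Finset.card_insert_of_notMem h2] at e2
  simp only [Nat.card_Icc, Nat.card_Ioc, Nat.add_sub_cancel, Nat.add_sub_cancel_left] at e0 e1 e2
  rw [← e0, ← e1, ← e2]
  exact hR.measureReal_blockEvent_insert _ _ _

/-- The indicators of the events that an integer is in the first block are exchangeable. -/
theorem IsGibbsPartition.measureReal_blockEvent [IsProbabilityMeasure P]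
    (hR : IsGibbsPartition P R α V) {A B : Finset ℕ} (hd : Disjoint A B) (hA : 0 ∉ A)
    (hB : 0 ∉ B) : P.real (blockEvent R A B) = blockWeight α V A.card B.card := by
  obtain ⟨m, hm⟩ : ∃ m, A ∪ B ⊆ Finset.Icc 1 m := by
    refine ⟨(A ∪ B).sup id, fun j hj => Finset.mem_Icc.2 ⟨Nat.one_le_iff_ne_zero.2 ?_,
      Finset.le_sup (f := id) hj⟩⟩
    rintro rfl
    rcases Finset.mem_union.1 hj with h | h
    · exact hA h
    · exact hB h
  -- Induct on the number of undecided integers up to m. Deciding one of them splits the event and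
  -- the weight in the same way.
  induction hk : (Finset.Icc 1 m \ (A ∪ B)).card generalizing A B with
  | zero =>
    rw [Finset.card_eq_zero, Finset.sdiff_eq_empty_iff_subset] at hk
    exact hR.measureReal_blockEvent_of_union_eq hd (hm.antisymm hk)
  | succ k ih =>
    obtain ⟨x, hx⟩ := Finset.card_pos.1 (by omega : 0 < (Finset.Icc 1 m \ (A ∪ B)).card)
    have hx' := Finset.mem_sdiff.1 hx
    have hxA : x ∉ A := fun h => hx'.2 (Finset.mem_union_left _ h)
    have hxB : x ∉ B := fun h => hx'.2 (Finset.mem_union_right _ h)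
    have hx0 : 0 ≠ x := by have := Finset.mem_Icc.1 hx'.1; omega
    have hcard : (Finset.Icc 1 m \ insert x (A ∪ B)).card = k := by
      rw [Finset.sdiff_insert, Finset.card_erase_of_mem hx, hk]; rfl
    have hsub : insert x (A ∪ B) ⊆ Finset.Icc 1 m := Finset.insert_subset hx'.1 hm
    rw [hR.measureReal_blockEvent_insert A B x, hR.blockWeight_eq_add,
      ih (Finset.disjoint_insert_left.2 ⟨hxB, hd⟩) (by simp [hA, hx0]) hB
        (by rwa [Finset.insert_union]) (by rwa [Finset.insert_union]),
      ih (Finset.disjoint_insert_right.2 ⟨hxA, hd⟩) hA (by simp [hB, hx0])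
        (by rwa [Finset.union_insert]) (by rwa [Finset.union_insert]),
      Finset.card_insert_of_notMem hxA, Finset.card_insert_of_notMem hxB]

end BlockEvent

/-! ### A strong law from second moments. -/

section Averages

variable {Ξ : Type*} [MeasurableSpace Ξ] {P : Measure Ξ} [IsProbabilityMeasure P]

/-- The averages of a `[0, 1]`-valued sequence whose mixed second moments depend only on whether the
indices are equal converge almost surely. -/
theorem ae_exists_tendsto_average {x : ℕ → Ξ → ℝ} (hm : ∀ i, Measurable (x i))
    (h01 : ∀ i ξ, x i ξ ∈ Icc (0 : ℝ) 1) {q₁ q₂ : ℝ}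
    (hq : ∀ i j, ∫ ξ, x i ξ * x j ξ ∂P = if i = j then q₁ else q₂) :
    ∀ᵐ ξ ∂P, ∃ l, Tendsto (fun n : ℕ => (∑ i ∈ Finset.range n, x i ξ) / n) atTop (𝓝 l) := by
  have hint : ∀ i j, Integrable (fun ξ => x i ξ * x j ξ) P := fun i j =>
    Integrable.of_bound ((hm i).mul (hm j)).aestronglyMeasurable 1 (ae_of_all _ fun ξ => by
      have h1 := h01 i ξ
      have h2 := h01 j ξ
      rw [Real.norm_of_nonneg (mul_nonneg h1.1 h2.1)]
      exact mul_le_one₀ h1.2 h2.1 h2.2)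
  set u : ℕ → Ξ → ℝ := fun n ξ => ∑ i ∈ Finset.range n, x i ξ with hu
  have hmix : ∀ n m, n ≤ m → ∫ ξ, u n ξ * u m ξ ∂P = n * m * q₂ + n * (q₁ - q₂) := by
    intro n m hnm
    simp only [hu, Finset.sum_mul_sum]
    rw [integral_finsetSum _ fun i _ => integrable_finsetSum _ fun j _ => hint i j]
    have : ∀ i ∈ Finset.range n, ∫ ξ, ∑ j ∈ Finset.range m, x i ξ * x j ξ ∂P =
        m * q₂ + (q₁ - q₂) := by
      intro i hi
      rw [integral_finsetSum _ fun j _ => hint i j]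
      simp_rw [hq]
      have h2 : ∀ j, (if i = j then q₁ else q₂) = q₂ + if i = j then q₁ - q₂ else 0 := fun j => by
        split_ifs <;> ring
      simp_rw [h2]
      have hi' := (Finset.mem_range.1 hi).trans_le hnm
      rw [Finset.sum_add_distrib, Finset.sum_ite_eq, if_pos (Finset.mem_range.2 hi')]
      simp
    rw [Finset.sum_congr rfl this]
    simp; ring
  have huint : ∀ n m, Integrable (fun ξ => u n ξ * u m ξ) P := fun n m => by
    simp only [hu, Finset.sum_mul_sum]
    exact integrable_finsetSum _ fun i _ => integrable_finsetSum _ fun j _ => hint i j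
  -- Fourth powers grow fast enough for the increments below to be summable, while c (k+1) / c k → 1
  -- allows interpolation back to all n.
  set c : ℕ → ℕ := fun k => (k + 1) ^ 4 with hc
  have hcpos : ∀ k, (0 : ℝ) < c k := fun k => by simp only [hc]; positivity
  set D : ℕ → Ξ → ℝ := fun k ξ => u (c k) ξ / c k - u (c (k + 1)) ξ / c (k + 1) with hD
  have hDm : ∀ k, Measurable (D k) := fun k => by
    simp only [hD, hu]; fun_prop
  have hexp : ∀ k ξ, D k ξ ^ 2 = u (c k) ξ * u (c k) ξ / (c k * c k) -
      2 / (c k * c (k + 1)) * (u (c k) ξ * u (c (k + 1)) ξ) +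
      u (c (k + 1)) ξ * u (c (k + 1)) ξ / (c (k + 1) * c (k + 1)) := by
    intro k ξ
    simp only [hD]
    have := (hcpos k).ne'
    have := (hcpos (k + 1)).ne'
    field_simp
    ring
  have hDint : ∀ k, Integrable (fun ξ => D k ξ ^ 2) P := fun k => by
    simp_rw [hexp]
    exact (((huint _ _).div_const _).sub ((huint _ _).const_mul _)).add ((huint _ _).div_const _)
  have hq01 : q₁ - q₂ ≤ 1 := by
    have h1 := hq 0 0
    have h2 := hq 0 1
    simp only [if_true, zero_ne_one, if_false] at h1 h2
    have h3 : q₁ ≤ 1 := by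
      rw [← h1]
      calc ∫ ξ, x 0 ξ * x 0 ξ ∂P ≤ ∫ _, (1 : ℝ) ∂P := by
            refine integral_mono (hint 0 0) (integrable_const _) fun ξ => ?_
            exact mul_le_one₀ (h01 0 ξ).2 (h01 0 ξ).1 (h01 0 ξ).2
        _ = 1 := by simp
    have h4 : 0 ≤ q₂ := by
      rw [← h2]
      exact integral_nonneg fun ξ => mul_nonneg (h01 0 ξ).1 (h01 1 ξ).1
    linarith
  -- The part n m q₂ of the mixed moments cancels, leaving (q₁ - q₂)(1 / c k - 1 / c (k+1)).
  have hDval : ∀ k, ∫ ξ, D k ξ ^ 2 ∂P ≤ 1 / ((k : ℝ) + 1) ^ 4 := by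
    intro k
    simp_rw [hexp]
    have hle : c k ≤ c (k + 1) := Nat.pow_le_pow_left (by omega) 4
    refine (le_of_eq (integral_add (((huint _ _).div_const _).sub ((huint _ _).const_mul _))
      ((huint _ _).div_const _))).trans ?_
    simp only [Pi.sub_apply]
    rw [integral_sub ((huint _ _).div_const _) ((huint _ _).const_mul _), integral_div,
      integral_div, integral_const_mul, hmix _ _ le_rfl, hmix _ _ le_rfl, hmix _ _ hle]
    have h1 : ((c k : ℕ) : ℝ) = ((k : ℝ) + 1) ^ 4 := by simp [hc]
    rw [← h1]
    have hp := hcpos k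
    have hp' := hcpos (k + 1)
    have hle' : (c k : ℝ) ≤ c (k + 1) := by exact_mod_cast hle
    have : (((c k : ℝ) * c k * q₂ + c k * (q₁ - q₂)) / (c k * c k) -
        2 / (c k * c (k + 1)) * (c k * c (k + 1) * q₂ + c k * (q₁ - q₂)) +
        ((c (k + 1) : ℝ) * c (k + 1) * q₂ + c (k + 1) * (q₁ - q₂)) / (c (k + 1) * c (k + 1))) =
        (q₁ - q₂) * (1 / c k - 1 / c (k + 1)) := by
      field_simp; ring
    rw [this]
    have h5 : 0 ≤ 1 / (c k : ℝ) - 1 / c (k + 1) :=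
      sub_nonneg.2 (one_div_le_one_div_of_le hp hle')
    have h6 : 0 ≤ 1 / (c (k + 1) : ℝ) := by positivity
    nlinarith
  -- With the weight (k+1)² the expectations are still summable, and |D| ≤ (k+1)² D² + (k+1)⁻² then
  -- makes the increments absolutely summable.
  have hsum : ∀ᵐ ξ ∂P, Summable fun k : ℕ => ((k : ℝ) + 1) ^ 2 * D k ξ ^ 2 := by
    have hfin : ∫⁻ ξ, ∑' k : ℕ, ENNReal.ofReal (((k : ℝ) + 1) ^ 2 * D k ξ ^ 2) ∂P ≠ ∞ := by
      rw [lintegral_tsum fun k => (by have := hDm k; fun_prop)]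
      have hle : ∀ k : ℕ, ∫⁻ ξ, ENNReal.ofReal (((k : ℝ) + 1) ^ 2 * D k ξ ^ 2) ∂P ≤
          ENNReal.ofReal (1 / ((k : ℝ) + 1) ^ 2) := by
        intro k
        rw [← ofReal_integral_eq_lintegral_ofReal ((hDint k).const_mul _)
          (ae_of_all _ fun ξ => by positivity), integral_const_mul]
        refine ENNReal.ofReal_le_ofReal ?_
        calc ((k : ℝ) + 1) ^ 2 * ∫ ξ, D k ξ ^ 2 ∂P
            ≤ ((k : ℝ) + 1) ^ 2 * (1 / ((k : ℝ) + 1) ^ 4) := by gcongr; exact hDval k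
          _ = _ := by field_simp
      refine ne_top_of_le_ne_top ?_ (ENNReal.tsum_le_tsum hle)
      have : Summable fun k : ℕ => 1 / ((k : ℝ) + 1) ^ 2 := by
        have := (summable_nat_add_iff 1).2 (Real.summable_one_div_nat_pow.2 one_lt_two)
        simpa using this
      exact this.tsum_ofReal_ne_top
    filter_upwards [ae_lt_top (Measurable.tsum fun k => by have := hDm k; fun_prop) hfin]
      with ξ hξ
    have h1 := ENNReal.summable_toReal hξ.ne
    refine h1.congr fun k => ?_
    rw [ENNReal.toReal_ofReal (by positivity)]
  filter_upwards [hsum] with ξ hξ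
  have hsumabs : Summable fun k => dist (u (c k) ξ / c k) (u (c (k + 1)) ξ / c (k + 1)) := by
    have h2 : Summable fun k : ℕ => 1 / ((k : ℝ) + 1) ^ 2 := by
      have := (summable_nat_add_iff 1).2 (Real.summable_one_div_nat_pow.2 one_lt_two)
      simpa using this
    refine Summable.of_nonneg_of_le (fun k => dist_nonneg) (fun k => ?_) (hξ.add h2)
    rw [Real.dist_eq]
    have hk : (0 : ℝ) < (k : ℝ) + 1 := by positivity
    set d := u (c k) ξ / c k - u (c (k + 1)) ξ / c (k + 1) with hd
    have h3 : D k ξ = d := rfl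
    rw [h3]
    have h4 : |d| = (((k : ℝ) + 1) * |d|) * (1 / ((k : ℝ) + 1)) := by field_simp
    have h5 : ((k : ℝ) + 1) ^ 2 * d ^ 2 + 1 / ((k : ℝ) + 1) ^ 2 =
        (((k : ℝ) + 1) * |d|) ^ 2 + (1 / ((k : ℝ) + 1)) ^ 2 := by
      rw [mul_pow, sq_abs]; simp
    rw [h5]
    have h6 : 0 ≤ (((k : ℝ) + 1) * |d|) := by positivity
    have h7 : 0 ≤ 1 / ((k : ℝ) + 1) := by positivity
    nlinarith [sq_nonneg ((((k : ℝ) + 1) * |d|) - 1 / ((k : ℝ) + 1)), mul_nonneg h6 h7]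
  obtain ⟨l, hl⟩ := cauchySeq_tendsto_of_complete (cauchySeq_of_summable_dist hsumabs)
  refine ⟨l, tendsto_div_of_monotone_of_exists_subseq_tendsto_div (fun n => u n ξ) l ?_ ?_⟩
  · exact monotone_nat_of_le_succ fun n => by
      simp only [hu, Finset.sum_range_succ]
      linarith [(h01 n ξ).1]
  · intro a ha
    refine ⟨c, ?_, ?_, hl⟩
    · have hlim : Tendsto (fun n : ℕ => (1 + 1 / ((n : ℝ) + 1)) ^ 4) atTop (𝓝 1) := by
        have := (tendsto_one_div_add_atTop_nhds_zero_nat (𝕜 := ℝ)).const_add 1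
        simpa using this.pow 4
      filter_upwards [hlim.eventually (gt_mem_nhds ha)] with n hn
      have e : ((c (n + 1) : ℕ) : ℝ) = (1 + 1 / ((n : ℝ) + 1)) ^ 4 * c n := by
        simp only [hc]; push_cast; field_simp
      rw [e]
      exact mul_le_mul_of_nonneg_right hn.le (hcpos n).le
    · refine tendsto_atTop_mono (fun n => ?_) tendsto_id
      simp only [hc, id]
      calc n ≤ n + 1 := by omega
        _ ≤ (n + 1) ^ 4 := Nat.le_self_pow (by norm_num) _

end Averages

/-! ### Moments of the structural distribution. -/

section StructuralDist

variable {Ξ : Type*}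

/-- The indicator of the event that the integer represented by `i + 1` is in the first block. -/
def firstBlockIndicator (R : Ξ → Setoid ℕ) (i : ℕ) : Ξ → ℝ :=
  {ξ | R ξ 0 (i + 1)}.indicator 1

theorem firstBlockIndicator_mem_Icc (R : Ξ → Setoid ℕ) (i : ℕ) (ξ : Ξ) :
    firstBlockIndicator R i ξ ∈ Icc (0 : ℝ) 1 := by
  by_cases h : ξ ∈ {ξ | R ξ 0 (i + 1)} <;> simp [firstBlockIndicator, h]

theorem ncard_firstBlock (R : Ξ → Setoid ℕ) (ξ : Ξ) (n : ℕ) :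
    ({j : ℕ | j < n + 1 ∧ R ξ 0 j}.ncard : ℝ) =
      ∑ i ∈ Finset.range n, firstBlockIndicator R i ξ + 1 := by
  classical
  have h1 : {j : ℕ | j < n + 1 ∧ R ξ 0 j} =
      ((Finset.range (n + 1)).filter fun j => R ξ 0 j : Finset ℕ) := by
    ext j; simp
  rw [h1, Set.ncard_coe_finset, Finset.card_filter, Finset.sum_range_succ',
    if_pos ((R ξ).refl' 0)]
  push_cast
  congr 1

theorem average_firstBlockIndicator_mem_Icc (R : Ξ → Setoid ℕ) (n : ℕ) (ξ : Ξ) :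
    (∑ i ∈ Finset.range n, firstBlockIndicator R i ξ) / n ∈ Icc (0 : ℝ) 1 := by
  have h0 : 0 ≤ ∑ i ∈ Finset.range n, firstBlockIndicator R i ξ :=
    Finset.sum_nonneg fun i _ => (firstBlockIndicator_mem_Icc R i ξ).1
  refine ⟨by positivity, div_le_one_of_le₀ ?_ (Nat.cast_nonneg n)⟩
  calc _ ≤ ∑ i ∈ Finset.range n, (1 : ℝ) :=
        Finset.sum_le_sum fun i _ => (firstBlockIndicator_mem_Icc R i ξ).2
    _ = n := by simp

variable [MeasurableSpace Ξ] {P : Measure Ξ} {R : Ξ → Setoid ℕ} {α : ℝ} {V : ℕ → ℕ → ℝ}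

theorem IsGibbsPartition.measurable_firstBlockIndicator (hR : IsGibbsPartition P R α V) (i : ℕ) :
    Measurable (firstBlockIndicator R i) :=
  measurable_one.indicator (hR.measurable 0 (i + 1))

variable [IsProbabilityMeasure P]

/-- By exchangeability the second moments of the indicators depend only on whether i = j, so the
averages converge. The first integer itself, absent from the sums, contributes only 1 / n, and the
`limsup` is then the limit. -/
theorem IsGibbsPartition.ae_tendsto_firstFreq (hR : IsGibbsPartition P R α V) :
    ∀ᵐ ξ ∂P, Tendsto (fun n : ℕ => (∑ i ∈ Finset.range n, firstBlockIndicator R i ξ) / n) atTop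
      (𝓝 (firstFreq R ξ)) := by
  have hq : ∀ i j, ∫ ξ, firstBlockIndicator R i ξ * firstBlockIndicator R j ξ ∂P =
      if i = j then blockWeight α V 1 0 else blockWeight α V 2 0 := by
    intro i j
    have h1 : (fun ξ => firstBlockIndicator R i ξ * firstBlockIndicator R j ξ) =
        (blockEvent R {i + 1, j + 1} ∅).indicator 1 := by
      ext ξ
      by_cases hi : R ξ 0 (i + 1) <;> by_cases hj : R ξ 0 (j + 1) <;>
        simp [firstBlockIndicator, blockEvent, indicator, hi, hj]
    rw [h1, integral_indicator_one (hR.measurableSet_blockEvent _ _),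
      hR.measureReal_blockEvent (by simp) (by simp) (by simp)]
    by_cases hij : i = j
    · simp [hij]
    · rw [if_neg hij, Finset.card_pair (by simpa using hij), Finset.card_empty]
  filter_upwards [ae_exists_tendsto_average hR.measurable_firstBlockIndicator
    (firstBlockIndicator_mem_Icc R) hq] with ξ ⟨l, hl⟩
  have h2 : Tendsto (fun n : ℕ => ({j : ℕ | j < n ∧ R ξ 0 j}.ncard : ℝ) / n) atTop (𝓝 l) := by
    rw [← tendsto_add_atTop_iff_nat 1]
    have h3 : Tendsto (fun n : ℕ => (∑ i ∈ Finset.range n, firstBlockIndicator R i ξ) / n *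
        ((n : ℝ) / (n + 1)) + 1 / ((n : ℝ) + 1)) atTop (𝓝 (l * 1 + 0)) :=
      (hl.mul (tendsto_natCast_div_add_atTop 1)).add tendsto_one_div_add_atTop_nhds_zero_nat
    rw [mul_one, add_zero] at h3
    refine h3.congr fun n => ?_
    rw [ncard_firstBlock]
    rcases n.eq_zero_or_pos with rfl | hn
    · simp
    · have : (0 : ℝ) < n := by exact_mod_cast hn
      push_cast
      field_simp
  rwa [firstFreq, h2.limsup_eq]

theorem IsGibbsPartition.aemeasurable_firstFreq (hR : IsGibbsPartition P R α V) :
    AEMeasurable (firstFreq R) P := by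
  refine aemeasurable_of_tendsto_metrizable_ae atTop (fun n => ?_) hR.ae_tendsto_firstFreq
  have := hR.measurable_firstBlockIndicator
  fun_prop

theorem IsGibbsPartition.ae_firstFreq_mem_Icc (hR : IsGibbsPartition P R α V) :
    ∀ᵐ ξ ∂P, firstFreq R ξ ∈ Icc (0 : ℝ) 1 := by
  filter_upwards [hR.ae_tendsto_firstFreq] with ξ hξ
  exact isClosed_Icc.mem_of_tendsto hξ
    (Eventually.of_forall fun n => average_firstBlockIndicator_mem_Icc R n ξ)

/-- Replace one factor P₁ by the average of the indicators. Each indicator enlarges `T` by one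
element, except for the finitely many indices already in `T`, which disappear in the Cesàro limit.
-/
theorem IsGibbsPartition.setIntegral_firstFreq_pow (hR : IsGibbsPartition P R α V) (b : ℕ)
    {T : Finset ℕ} (hT : 0 ∉ T) :
    ∫ ξ in blockEvent R T ∅, firstFreq R ξ ^ b ∂P = blockWeight α V (T.card + b) 0 := by
  induction b generalizing T with
  | zero => simp [hR.measureReal_blockEvent (Finset.disjoint_empty_right T) hT (by simp)]
  | succ b ih =>
    have hmeas := hR.aemeasurable_firstFreq
    have hxm := hR.measurable_firstBlockIndicator
    have hIcc := hR.ae_firstFreq_mem_Icc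
    have hlim : Tendsto (fun n : ℕ => ∫ ξ in blockEvent R T ∅, firstFreq R ξ ^ b *
        ((∑ i ∈ Finset.range n, firstBlockIndicator R i ξ) / n) ∂P) atTop
        (𝓝 (∫ ξ in blockEvent R T ∅, firstFreq R ξ ^ b * firstFreq R ξ ∂P)) := by
      refine tendsto_integral_of_dominated_convergence (fun _ => 1) (fun n => ?_)
        (integrable_const _) (fun n => ?_) ?_
      · exact ((hmeas.pow_const b).mul (by fun_prop)).aestronglyMeasurable.restrict
      · filter_upwards [ae_restrict_of_ae hIcc] with ξ hξ
        have h2 := average_firstBlockIndicator_mem_Icc R n ξ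
        rw [Real.norm_of_nonneg (mul_nonneg (pow_nonneg hξ.1 _) h2.1)]
        exact mul_le_one₀ (pow_le_one₀ hξ.1 hξ.2) h2.1 h2.2
      · filter_upwards [ae_restrict_of_ae hR.ae_tendsto_firstFreq] with ξ hξ
        exact hξ.const_mul _
    have hterm : ∀ i, ∫ ξ in blockEvent R T ∅, firstFreq R ξ ^ b * firstBlockIndicator R i ξ ∂P =
        blockWeight α V ((insert (i + 1) T).card + b) 0 := by
      intro i
      rw [← ih (T := insert (i + 1) T) (by simp [hT])]
      have h1 : (fun ξ => firstFreq R ξ ^ b * firstBlockIndicator R i ξ) =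
          {ξ | R ξ 0 (i + 1)}.indicator fun ξ => firstFreq R ξ ^ b := by
        ext ξ
        by_cases hi : R ξ 0 (i + 1) <;> simp [firstBlockIndicator, indicator, hi]
      rw [h1, setIntegral_indicator (hR.measurable 0 (i + 1))]
      congr 2
      ext ξ
      simp only [blockEvent, mem_inter_iff, mem_ofPred_eq, Finset.forall_mem_insert]
      tauto
    have hint : ∀ i, Integrable (fun ξ => firstFreq R ξ ^ b * firstBlockIndicator R i ξ)
        (P.restrict (blockEvent R T ∅)) := by
      intro i
      refine Integrable.of_bound
        ((hmeas.pow_const b).mul (hxm i).aemeasurable).aestronglyMeasurable.restrict 1 ?_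
      filter_upwards [ae_restrict_of_ae hIcc] with ξ hξ
      have h2 := firstBlockIndicator_mem_Icc R i ξ
      rw [Real.norm_of_nonneg (mul_nonneg (pow_nonneg hξ.1 _) h2.1)]
      exact mul_le_one₀ (pow_le_one₀ hξ.1 hξ.2) h2.1 h2.2
    have hces : Tendsto (fun n : ℕ => (n⁻¹ : ℝ) * ∑ i ∈ Finset.range n,
        blockWeight α V ((insert (i + 1) T).card + b) 0) atTop
        (𝓝 (blockWeight α V (T.card + (b + 1)) 0)) := by
      refine Tendsto.cesaro (tendsto_const_nhds.congr' ?_)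
      filter_upwards [eventually_ge_atTop (T.sup id)] with i hi
      have : i + 1 ∉ T := fun h => by
        have := Finset.le_sup (f := id) h
        simp only [id] at this
        omega
      rw [Finset.card_insert_of_notMem this]
      congr 1
      omega
    have heq : (fun n : ℕ => ∫ ξ in blockEvent R T ∅, firstFreq R ξ ^ b *
        ((∑ i ∈ Finset.range n, firstBlockIndicator R i ξ) / n) ∂P) = fun n : ℕ => (n⁻¹ : ℝ) *
        ∑ i ∈ Finset.range n, blockWeight α V ((insert (i + 1) T).card + b) 0 := by
      ext n
      simp_rw [← hterm]
      rw [← integral_finsetSum _ fun i _ => hint i, ← integral_const_mul]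
      congr 1
      ext ξ
      rw [Finset.mul_sum, Finset.sum_div, Finset.mul_sum]
      exact Finset.sum_congr rfl fun i _ => by ring
    rw [heq] at hlim
    simp_rw [pow_succ]
    exact tendsto_nhds_unique hlim hces

theorem IsGibbsPartition.integrable_firstFreq (hR : IsGibbsPartition P R α V) (a b : ℕ) :
    Integrable (fun ξ => firstFreq R ξ ^ a * (1 - firstFreq R ξ) ^ b) P := by
  have hmeas := hR.aemeasurable_firstFreq
  refine Integrable.of_bound ((hmeas.pow_const a).mul
    ((aemeasurable_const.sub hmeas).pow_const b)).aestronglyMeasurable 1 ?_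
  filter_upwards [hR.ae_firstFreq_mem_Icc] with ξ hξ
  have h1 : 0 ≤ 1 - firstFreq R ξ := by linarith [hξ.2]
  have h2 : 1 - firstFreq R ξ ≤ 1 := by linarith [hξ.1]
  rw [Real.norm_of_nonneg (mul_nonneg (pow_nonneg hξ.1 _) (pow_nonneg h1 _))]
  exact mul_le_one₀ (pow_le_one₀ hξ.1 hξ.2) (pow_nonneg h1 _) (pow_le_one₀ h1 h2)

/-- Both sides satisfy f(a, b+1) = f(a, b) - f(a+1, b), which reduces the claim to the pure powers b
= 0. -/
theorem IsGibbsPartition.integral_firstFreq (hR : IsGibbsPartition P R α V) (a b : ℕ) :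
    ∫ ξ, firstFreq R ξ ^ a * (1 - firstFreq R ξ) ^ b ∂P = blockWeight α V a b := by
  have hint := hR.integrable_firstFreq
  induction b generalizing a with
  | zero =>
    have := hR.setIntegral_firstFreq_pow a (T := ∅) (by simp)
    have h2 : blockEvent R ∅ ∅ = univ := by ext; simp [blockEvent]
    simpa [h2] using this
  | succ b ih =>
    have h1 : ∀ ξ, firstFreq R ξ ^ a * (1 - firstFreq R ξ) ^ (b + 1) =
        firstFreq R ξ ^ a * (1 - firstFreq R ξ) ^ b -
        firstFreq R ξ ^ (a + 1) * (1 - firstFreq R ξ) ^ b := fun ξ => by ring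
    simp_rw [h1]
    rw [integral_sub (hint _ _) (hint _ _), ih, ih, hR.blockWeight_eq_add a b]
    ring

theorem IsGibbsPartition.blockWeight_nonneg (hR : IsGibbsPartition P R α V) (a b : ℕ) :
    0 ≤ blockWeight α V a b := by
  rw [← hR.integral_firstFreq]
  refine integral_nonneg_of_ae ?_
  filter_upwards [hR.ae_firstFreq_mem_Icc] with ξ hξ
  exact mul_nonneg (pow_nonneg hξ.1 _) (pow_nonneg (by linarith [hξ.2]) _)

theorem IsGibbsPartition.ae_structuralDist (hR : IsGibbsPartition P R α V)
    (h0 : ∀ᵐ ξ ∂P, 0 < firstFreq R ξ) : ∀ᵐ p ∂structuralDist P R, p ∈ Ioc (0 : ℝ) 1 := by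
  refine (ae_map_iff hR.aemeasurable_firstFreq measurableSet_Ioc).2 ?_
  filter_upwards [h0, hR.ae_firstFreq_mem_Icc] with ξ h1 h2 using ⟨h1, h2.2⟩

theorem IsGibbsPartition.lintegral_structuralDist (hR : IsGibbsPartition P R α V) (a b : ℕ) :
    ∫⁻ p, ENNReal.ofReal (p ^ a * (1 - p) ^ b) ∂structuralDist P R =
      ENNReal.ofReal (blockWeight α V a b) := by
  rw [structuralDist, lintegral_map' (by fun_prop) hR.aemeasurable_firstFreq,
    ← hR.integral_firstFreq, ofReal_integral_eq_lintegral_ofReal (hR.integrable_firstFreq a b)]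
  filter_upwards [hR.ae_firstFreq_mem_Icc] with ξ hξ
  exact mul_nonneg (pow_nonneg hξ.1 _) (pow_nonneg (by linarith [hξ.2]) _)

end StructuralDist

/-! ### The exponential on [0, ∞] and the Poisson generating function. -/

section Lap

/-- The function `x ↦ exp (-x)` on `[0, ∞]`. -/
def lap (x : ℝ≥0∞) : ℝ≥0∞ := EReal.exp (-(x : EReal))

@[simp]
theorem lap_zero : lap 0 = 1 := by simp [lap]

theorem lap_add (x y : ℝ≥0∞) : lap (x + y) = lap x * lap y := by
  rw [lap, lap, lap, ← EReal.exp_add, EReal.coe_ennreal_add, EReal.neg_add]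
  · rw [sub_eq_add_neg]
  · exact Or.inl (EReal.coe_ennreal_ne_bot x)
  · exact Or.inr (EReal.coe_ennreal_ne_bot y)

theorem lap_sum {ι : Type*} (s : Finset ι) (f : ι → ℝ≥0∞) :
    lap (∑ i ∈ s, f i) = ∏ i ∈ s, lap (f i) := by
  classical
  induction s using Finset.induction_on with
  | empty => simp
  | insert a s ha ih => rw [Finset.sum_insert ha, Finset.prod_insert ha, lap_add, ih]

theorem lap_natCast_mul (n : ℕ) (x : ℝ≥0∞) : lap (n * x) = lap x ^ n := by
  have := lap_sum (Finset.range n) fun _ => x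
  simpa using this

theorem lap_antitone : Antitone lap := fun x y h => by
  rw [lap, lap, EReal.exp_le_exp_iff, EReal.neg_le_neg_iff]
  exact_mod_cast h

theorem lap_le_one (x : ℝ≥0∞) : lap x ≤ 1 := by
  rw [← lap_zero]; exact lap_antitone (zero_le)

theorem lap_ne_top (x : ℝ≥0∞) : lap x ≠ ∞ := ((lap_le_one x).trans_lt ENNReal.one_lt_top).ne

theorem lap_ofReal {x : ℝ} (hx : 0 ≤ x) :
    lap (ENNReal.ofReal x) = ENNReal.ofReal (Real.exp (-x)) := by
  rw [lap, EReal.coe_ennreal_ofReal, max_eq_left hx, ← EReal.coe_neg, EReal.exp_coe]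

theorem continuous_lap : Continuous lap :=
  ENNReal.continuous_exp.comp (continuous_neg.comp continuous_coe_ennreal_ereal)

@[fun_prop]
theorem measurable_lap : Measurable lap := continuous_lap.measurable

theorem continuous_one_sub_lap : Continuous fun x => 1 - lap x :=
  (ENNReal.continuous_sub_left ENNReal.one_ne_top).comp continuous_lap

theorem one_sub_lap_mono : Monotone fun x => 1 - lap x := fun _ _ h =>
  tsub_le_tsub_left (lap_antitone h) 1

theorem lintegral_pow_poissonMeasure (r : NNReal) {s : ℝ≥0∞} (hs : s ≤ 1) :
    ∫⁻ m, s ^ m ∂poissonMeasure r = lap (r * (1 - s)) := by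
  obtain ⟨t, rfl⟩ : ∃ t : NNReal, s = t := ⟨s.toNNReal, by
    rw [ENNReal.coe_toNNReal (hs.trans_lt ENNReal.one_lt_top).ne]⟩
  have ht : t ≤ 1 := by exact_mod_cast hs
  have h1 : HasSum (fun n : ℕ => Real.exp (-r) * r ^ n / n ! * (t : ℝ) ^ n)
      (Real.exp (-(r * (1 - t)))) := by
    have h2 := (NormedSpace.expSeries_div_hasSum_exp ((r : ℝ) * t)).mul_left (Real.exp (-r))
    rw [← Real.exp_eq_exp_ℝ, ← Real.exp_add] at h2
    convert! h2 using 1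
    · ext n; rw [mul_pow]; ring
    · congr 1; ring
  have h3 : (r : ℝ≥0∞) * (1 - t) = ENNReal.ofReal (r * (1 - t)) := by
    rw [ENNReal.ofReal_mul r.coe_nonneg, ENNReal.ofReal_sub _ t.coe_nonneg]
    simp
  rw [h3, lap_ofReal (mul_nonneg r.coe_nonneg (sub_nonneg.2 (by exact_mod_cast ht))), ← h1.tsum_eq,
    ENNReal.ofReal_tsum_of_nonneg (fun n => by positivity) h1.summable, poissonMeasure,
    lintegral_sum_measure]
  refine tsum_congr fun n => ?_
  rw [lintegral_smul_measure, lintegral_dirac, smul_eq_mul,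
    ENNReal.ofReal_mul (by positivity), ENNReal.ofReal_pow t.coe_nonneg, ENNReal.ofReal_coe_nnreal]

end Lap

/-! ### The Laplace functional of a Poisson process. -/

section Poisson

variable {Ξ E : Type*}

open Classical in
/-- The sum of `g` over the points of the point process with points `X k`, `k < N`. -/
def pointSum (N : Ξ → ℕ∞) (X : ℕ → Ξ → E) (g : E → ℝ≥0∞) (ξ : Ξ) : ℝ≥0∞ :=
  ∑' k : ℕ, if (k : ℕ∞) < N ξ then g (X k ξ) else 0

theorem pointCount_eq_pointSum (N : Ξ → ℕ∞) (X : ℕ → Ξ → E) (A : Set E) (ξ : Ξ) :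
    (pointCount N X A ξ : ℝ≥0∞) = pointSum N X (A.indicator 1) ξ := by
  classical
  rw [pointCount, ← ENNReal.tsum_set_one, pointSum, tsum_subtype _ fun _ => (1 : ℝ≥0∞)]
  refine tsum_congr fun k => ?_
  by_cases h1 : (k : ℕ∞) < N ξ <;> by_cases h2 : X k ξ ∈ A <;> simp [indicator, h1, h2]

theorem tendsto_pointSum (N : Ξ → ℕ∞) (X : ℕ → Ξ → E) {f : ℕ → E → ℝ≥0∞} {g : E → ℝ≥0∞}
    (hmono : ∀ x, Monotone fun n => f n x)
    (hlim : ∀ x, Tendsto (fun n => f n x) atTop (𝓝 (g x))) (ξ : Ξ) :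
    Tendsto (fun n => pointSum N X (f n) ξ) atTop (𝓝 (pointSum N X g ξ)) := by
  classical
  simp only [pointSum, ← lintegral_count]
  refine lintegral_tendsto_of_tendsto_of_monotone (fun n => Measurable.of_discrete.aemeasurable)
    (ae_of_all _ fun k => ?_) (ae_of_all _ fun k => ?_)
  · split_ifs
    · exact hmono _
    · exact monotone_const
  · split_ifs
    · exact hlim _
    · exact tendsto_const_nhds

variable [MeasurableSpace Ξ] [MeasurableSpace E] {P : Measure Ξ} {N : Ξ → ℕ∞}
  {X : ℕ → Ξ → E} {ν : Measure E}

theorem measurable_pointSum (hN : Measurable N) (hX : ∀ k, Measurable (X k)) {g : E → ℝ≥0∞}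
    (hg : Measurable g) : Measurable (pointSum N X g) := by
  classical
  refine Measurable.tsum fun k => Measurable.ite ?_ (hg.comp (hX k)) measurable_const
  exact hN (MeasurableSet.of_discrete (s := {a | (k : ℕ∞) < a}))

theorem IsPoissonProcess.lintegral_lap_count (h : IsPoissonProcess P N X ν) {A : Set E}
    (hA : MeasurableSet A) (hνA : ν A ≠ ∞) (c : ℝ≥0∞) :
    ∫⁻ ξ, lap (c * (pointCount N X A ξ : ℝ≥0∞)) ∂P = lap (ν A * (1 - lap c)) := by
  have hlaw := h.poisson A hA hνA
  have h1 : ∫⁻ ξ, lap (c * (pointCount N X A ξ : ℝ≥0∞)) ∂P =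
      ∫⁻ m : ℕ∞, lap (c * (m : ℝ≥0∞)) ∂(P.map (pointCount N X A)) :=
    (lintegral_map' (f := fun m : ℕ∞ => lap (c * (m : ℝ≥0∞)))
      Measurable.of_discrete.aemeasurable hlaw.aemeasurable).symm
  rw [h1, hlaw.map_eq, lintegral_map Measurable.of_discrete Measurable.of_discrete]
  have h2 : ∀ m : ℕ, lap (c * (((m : ℕ) : ℕ∞) : ℝ≥0∞)) = lap c ^ m := fun m => by
    rw [mul_comm, ENat.toENNReal_coe, lap_natCast_mul]
  simp_rw [h2]
  rw [lintegral_pow_poissonMeasure _ (lap_le_one c), ENNReal.coe_toNNReal hνA]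

/-- The value 0 is left out because its level set may have infinite intensity. -/
theorem simpleFunc_apply_eq_sum (f : SimpleFunc E ℝ≥0∞) {h : ℝ≥0∞ → ℝ≥0∞} (h0 : h 0 = 0)
    (x : E) :
    h (f x) = ∑ r ∈ f.range.filter (· ≠ 0), h r * (f ⁻¹' {r}).indicator 1 x := by
  classical
  have h1 : ∀ r, h r * (f ⁻¹' {r}).indicator (1 : E → ℝ≥0∞) x = if f x = r then h r else 0 := by
    intro r
    by_cases hr : f x = r <;> simp [indicator, hr]
  simp_rw [h1]
  rw [Finset.sum_ite_eq]
  by_cases hx : f x = 0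
  · simp [hx, h0]
  · rw [if_pos]; simp [hx]

/-- The level sets are disjoint, so their counts are independent Poisson variables and the transform
factors. -/
theorem IsPoissonProcess.lintegral_lap_pointSum_simpleFunc (h : IsPoissonProcess P N X ν)
    (f : SimpleFunc E ℝ≥0∞) (hf : ∀ r, r ≠ 0 → ν (f ⁻¹' {r}) ≠ ∞) :
    ∫⁻ ξ, lap (pointSum N X f ξ) ∂P = lap (∫⁻ x, 1 - lap (f x) ∂ν) := by
  classical
  set s := f.range.filter (· ≠ 0) with hs
  have hcm : ∀ A, MeasurableSet A → Measurable fun ξ => (pointCount N X A ξ : ℝ≥0∞) :=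
    fun A hA => by
      simp_rw [pointCount_eq_pointSum]
      exact measurable_pointSum h.measurable_card h.measurable_point
        (measurable_one.indicator hA)
  have h1 : ∀ ξ, pointSum N X f ξ = ∑ r ∈ s, r * (pointCount N X (f ⁻¹' {r}) ξ : ℝ≥0∞) := by
    intro ξ
    simp_rw [pointCount_eq_pointSum, pointSum, ← ENNReal.tsum_mul_left]
    rw [← Summable.tsum_finsetSum fun _ _ => ENNReal.summable]
    refine tsum_congr fun k => ?_
    by_cases hk : (k : ℕ∞) < N ξ
    · simp only [hk, if_true]
      exact simpleFunc_apply_eq_sum f (h := id) rfl _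
    · simp [hk]
  have h2 : ∫⁻ x, 1 - lap (f x) ∂ν = ∑ r ∈ s, ν (f ⁻¹' {r}) * (1 - lap r) := by
    simp_rw [simpleFunc_apply_eq_sum f (h := fun r => 1 - lap r) (by simp)]
    rw [lintegral_finsetSum _ fun r _ =>
      (measurable_one.indicator (f.measurableSet_preimage _)).const_mul _]
    refine Finset.sum_congr rfl fun r _ => ?_
    rw [lintegral_const_mul _ (measurable_one.indicator (f.measurableSet_preimage _)),
      lintegral_indicator_one (f.measurableSet_preimage _), mul_comm]
  have hind : iIndepFun (fun (r : s) ξ => pointCount N X (f ⁻¹' {(r : ℝ≥0∞)}) ξ) P := by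
    have h3 := h.indep s.card (fun i => f ⁻¹' {(s.equivFin.symm i : ℝ≥0∞)})
      (fun i => f.measurableSet_preimage _) (fun i j hij => by
        refine Disjoint.preimage _ (disjoint_singleton.2 fun he => hij ?_)
        exact s.equivFin.symm.injective (Subtype.ext he))
    have h4 := h3.precomp s.equivFin.injective
    simpa using h4
  have hind2 := hind.comp (fun (r : s) (m : ℕ∞) => lap (r * (m : ℝ≥0∞)))
    fun r => Measurable.of_discrete
  simp_rw [h1, h2, lap_sum]
  rw [← Finset.prod_coe_sort s]
  simp_rw [← Finset.prod_coe_sort s]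
  have h5 := lintegral_prod_eq_prod_lintegral_of_indepFun Finset.univ _ hind2 fun r =>
    measurable_lap.comp ((hcm _ (f.measurableSet_preimage {(r : ℝ≥0∞)})).const_mul (r : ℝ≥0∞))
  refine h5.trans (Finset.prod_congr rfl fun r _ => ?_)
  exact h.lintegral_lap_count (f.measurableSet_preimage _)
    (hf _ (Finset.mem_filter.1 r.2).2) _

/-- The Laplace functional of a Poisson process. -/
theorem IsPoissonProcess.lintegral_lap_pointSum [IsProbabilityMeasure P] [SigmaFinite ν]
    (h : IsPoissonProcess P N X ν) {g : E → ℝ≥0∞} (hg : Measurable g) :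
    ∫⁻ ξ, lap (pointSum N X g ξ) ∂P = lap (∫⁻ x, 1 - lap (g x) ∂ν) := by
  -- Cutting off at the spanning sets gives the nonzero level sets finite intensity. The cut-off
  -- functions still increase to g.
  set f : ℕ → SimpleFunc E ℝ≥0∞ := fun m =>
    (SimpleFunc.eapprox g m).restrict (spanningSets ν m) with hf
  have hfx : ∀ m x, f m x = (spanningSets ν m).indicator (SimpleFunc.eapprox g m) x := fun m x =>
    SimpleFunc.restrict_apply _ (measurableSet_spanningSets ν m) x
  have hfin : ∀ m r, r ≠ 0 → ν (f m ⁻¹' {r}) ≠ ∞ := by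
    intro m r hr
    refine ((measure_mono fun x hx => ?_).trans_lt (measure_spanningSets_lt_top ν m)).ne
    by_contra hxs
    rw [mem_preimage, hfx, indicator_of_notMem hxs] at hx
    exact hr hx.symm
  have hmono : ∀ x, Monotone fun m => f m x := by
    intro x m m' hmm
    simp only [hfx]
    refine (indicator_le_indicator_of_subset (monotone_spanningSets ν hmm) (fun _ => zero_le)
      x).trans (indicator_le_indicator ?_)
    exact SimpleFunc.monotone_eapprox g hmm x
  have hlim : ∀ x, Tendsto (fun m => f m x) atTop (𝓝 (g x)) := by
    intro x
    have h1 : Tendsto (fun m => SimpleFunc.eapprox g m x) atTop (𝓝 (g x)) :=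
      SimpleFunc.tendsto_eapprox hg x
    refine h1.congr' ?_
    filter_upwards [eventually_ge_atTop (spanningSetsIndex ν x)] with m hm
    rw [hfx, indicator_of_mem]
    exact monotone_spanningSets ν hm (mem_spanningSetsIndex ν x)
  have hL : Tendsto (fun m => ∫⁻ ξ, lap (pointSum N X (f m) ξ) ∂P) atTop
      (𝓝 (∫⁻ ξ, lap (pointSum N X g ξ) ∂P)) := by
    refine tendsto_lintegral_of_dominated_convergence (fun _ => 1) (fun m => ?_)
      (fun m => ae_of_all _ fun ξ => lap_le_one _) (by simp) (ae_of_all _ fun ξ => ?_)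
    · exact measurable_lap.comp
        (measurable_pointSum h.measurable_card h.measurable_point (f m).measurable)
    · exact (continuous_lap.tendsto _).comp (tendsto_pointSum N X hmono hlim ξ)
  have hR : Tendsto (fun m => lap (∫⁻ x, 1 - lap (f m x) ∂ν)) atTop
      (𝓝 (lap (∫⁻ x, 1 - lap (g x) ∂ν))) := by
    refine (continuous_lap.tendsto _).comp
      (lintegral_tendsto_of_tendsto_of_monotone (fun m => ?_) (ae_of_all _ fun x => ?_)
        (ae_of_all _ fun x => ?_))
    · exact (continuous_one_sub_lap.measurable.comp (f m).measurable).aemeasurable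
    · exact fun m m' hmm => one_sub_lap_mono (hmono x hmm)
    · exact (continuous_one_sub_lap.tendsto _).comp (hlim x)
  refine tendsto_nhds_unique hL (hR.congr fun m => ?_)
  exact (h.lintegral_lap_pointSum_simpleFunc (f m) (hfin m)).symm

end Poisson

/-! ### Averaging over one uniform variable. -/

section Thinning

/-- The inverse of `lap`. -/
def negLog (s : ℝ≥0∞) : ℝ≥0∞ := (-ENNReal.log s).toENNReal

theorem lap_negLog {s : ℝ≥0∞} (hs : s ≤ 1) : lap (negLog s) = s := by
  have h : 0 ≤ -ENNReal.log s := by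
    rw [← neg_zero, EReal.neg_le_neg_iff]
    simpa using hs
  rw [lap, negLog, EReal.coe_toENNReal h, neg_neg, ENNReal.exp_log]

theorem measurable_negLog : Measurable negLog := by
  unfold negLog
  fun_prop

/-- The expectation of a variable that equals `s` with probability `p` and is `1` otherwise. -/
def thin (s : ℝ≥0∞) (p : ℝ) : ℝ≥0∞ :=
  ∫⁻ u in Ioo (0 : ℝ) 1, if u < p then s else 1

theorem thin_le_one {s : ℝ≥0∞} (hs : s ≤ 1) (p : ℝ) : thin s p ≤ 1 := by
  calc thin s p ≤ ∫⁻ u in Ioo (0 : ℝ) 1, 1 := by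
        refine lintegral_mono fun u => ?_
        split_ifs
        · exact hs
        · exact le_rfl
    _ = 1 := by simp

theorem thin_of_mem_Ioc (s : ℝ≥0∞) {p : ℝ} (hp : p ∈ Ioc (0 : ℝ) 1) :
    thin s p = ENNReal.ofReal p * s + ENNReal.ofReal (1 - p) := by
  have h1 : ∀ u : ℝ, (if u < p then s else 1) =
      (Iio p).indicator (fun _ => s) u + (Ici p).indicator (fun _ => 1) u := by
    intro u
    by_cases hu : u < p
    · simp [hu]
    · simp [hu, not_lt.1 hu]
  have h2 : Iio p ∩ Ioo (0 : ℝ) 1 = Ioo 0 p := by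
    ext u; simp only [mem_inter_iff, mem_Iio, mem_Ioo]
    exact ⟨fun h => ⟨h.2.1, h.1⟩, fun h => ⟨h.2, h.1, h.2.trans_le hp.2⟩⟩
  have h3 : Ici p ∩ Ioo (0 : ℝ) 1 = Ico p 1 := by
    ext u; simp only [mem_inter_iff, mem_Ici, mem_Ioo, mem_Ico]
    exact ⟨fun h => ⟨h.1, h.2.2⟩, fun h => ⟨h.1, hp.1.trans_le h.1, h.2⟩⟩
  simp_rw [thin, h1]
  rw [lintegral_add_left (measurable_const.indicator measurableSet_Iio),
    lintegral_indicator_const measurableSet_Iio, lintegral_indicator_const measurableSet_Ici,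
    Measure.restrict_apply measurableSet_Iio, Measure.restrict_apply measurableSet_Ici, h2, h3,
    Real.volume_Ioo, Real.volume_Ico, sub_zero, one_mul, mul_comm]

theorem measurable_thin : Measurable fun q : ℝ≥0∞ × ℝ => thin q.1 q.2 := by
  have h : Measurable fun r : (ℝ≥0∞ × ℝ) × ℝ => if r.2 < r.1.2 then r.1.1 else (1 : ℝ≥0∞) :=
    Measurable.ite (measurableSet_lt measurable_snd (measurable_snd.comp measurable_fst))
      (measurable_fst.comp measurable_fst) measurable_const
  exact h.lintegral_prod_right'

end Thinning

/-! ### The Laplace functional of the Bernoulli processes. -/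

section BernoulliSampling

variable {Ξ Ω : Type*} [MeasurableSpace Ω]

open Classical in
theorem lintegral_bernoulliProcess {N : Ξ → ℕ∞} {X : ℕ → Ξ → Ω × ℝ}
    {U : ℕ → ℕ → Ξ → ℝ} (j : ℕ) (ξ : Ξ) {f : Ω → ℝ≥0∞} (hf : Measurable f) :
    ∫⁻ ω, f ω ∂(bernoulliProcess N X U j ξ) =
      ∑' k : ℕ, if (k : ℕ∞) < N ξ ∧ U j k ξ < (X k ξ).2 then f (X k ξ).1 else 0 := by
  rw [bernoulliProcess, lintegral_sum_measure]
  refine tsum_congr fun k => ?_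
  split_ifs
  · rw [lintegral_dirac' _ hf]
  · simp

variable [MeasurableSpace Ξ] {P : Measure Ξ}
  {N : Ξ → ℕ∞} {X : ℕ → Ξ → Ω × ℝ} {U : ℕ → ℕ → Ξ → ℝ} {ν : Measure (Ω × ℝ)}

theorem measurableSet_index_lt (k : ℕ) : MeasurableSet {a : ℕ∞ | (k : ℕ∞) < a} :=
  MeasurableSet.of_discrete

theorem IsBernoulliSampling.measurable_bernoulliProcess (h : IsBernoulliSampling P N X U ν)
    (j : ℕ) : Measurable (bernoulliProcess N X U j) := by
  classical
  refine Measure.measurable_of_measurable_coe _ fun A hA => ?_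
  simp only [bernoulliProcess, Measure.sum_apply _ hA]
  refine Measurable.tsum fun k => ?_
  have h1 : ∀ ξ, (if (k : ℕ∞) < N ξ ∧ U j k ξ < (X k ξ).2 then Measure.dirac (X k ξ).1 else
      (0 : Measure Ω)) A = if (k : ℕ∞) < N ξ ∧ U j k ξ < (X k ξ).2 then
        A.indicator 1 (X k ξ).1 else 0 := by
    intro ξ
    split_ifs
    · rw [Measure.dirac_apply' _ hA]
    · rfl
  simp_rw [h1]
  refine Measurable.ite ?_ ((measurable_one.indicator hA).comp
    (measurable_fst.comp (h.poisson.measurable_point k))) measurable_const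
  exact (h.poisson.measurable_card (measurableSet_index_lt k)).inter
    (measurableSet_lt (h.measurable_uniform j k)
      (measurable_snd.comp (h.poisson.measurable_point k)))

open Classical in
/-- Conditional expectation given the points of the product over the first `M` points of the marks
`s j k` of the points that are selected. -/
theorem IsBernoulliSampling.lintegral_prod_mark [IsProbabilityMeasure P]
    (h : IsBernoulliSampling P N X U ν) {n : ℕ} {f : Fin n → Ω → ℝ≥0∞}
    (hf : ∀ j, Measurable (f j)) (M : ℕ) :
    ∫⁻ ξ, ∏ q ∈ Finset.univ ×ˢ Finset.range M, (if (q.2 : ℕ∞) < N ξ ∧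
        U (q.1 : Fin n) q.2 ξ < (X q.2 ξ).2 then f q.1 (X q.2 ξ).1 else 1) ∂P =
      ∫⁻ ξ, ∏ q ∈ Finset.univ ×ˢ Finset.range M, (if (q.2 : ℕ∞) < N ξ then
        thin (f (q.1 : Fin n) (X q.2 ξ).1) (X q.2 ξ).2 else 1) ∂P := by
  set Y : Ξ → ℕ∞ × (ℕ → Ω × ℝ) := fun ξ => (N ξ, fun k => X k ξ) with hY
  set W : Ξ → (ℕ × ℕ → ℝ) := fun ξ q => U q.1 q.2 ξ with hW
  have hYm : Measurable Y :=
    h.poisson.measurable_card.prodMk (measurable_pi_lambda _ h.poisson.measurable_point)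
  have hWm : Measurable W := measurable_pi_lambda _ fun q => h.measurable_uniform q.1 q.2
  let F : (ℕ∞ × (ℕ → Ω × ℝ)) → (ℕ × ℕ → ℝ) → Fin n × ℕ → ℝ≥0∞ := fun y w q =>
    if (q.2 : ℕ∞) < y.1 ∧ w (q.1, q.2) < (y.2 q.2).2 then f q.1 (y.2 q.2).1 else 1
  have hFm : ∀ q, Measurable fun r : (ℕ∞ × (ℕ → Ω × ℝ)) × (ℕ × ℕ → ℝ) => F r.1 r.2 q := by
    intro q
    have hp : Measurable fun r : (ℕ∞ × (ℕ → Ω × ℝ)) × (ℕ × ℕ → ℝ) => r.1.2 q.2 :=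
      (measurable_pi_apply q.2).comp (measurable_snd.comp measurable_fst)
    refine Measurable.ite ?_ ((hf q.1).comp (measurable_fst.comp hp)) measurable_const
    refine MeasurableSet.inter ((measurable_fst.comp measurable_fst) (measurableSet_index_lt q.2))
      (measurableSet_lt ?_ (measurable_snd.comp hp))
    exact (measurable_pi_apply _).comp measurable_snd
  have hprod : Measurable fun r : (ℕ∞ × (ℕ → Ω × ℝ)) × (ℕ × ℕ → ℝ) =>
      ∏ q ∈ Finset.univ ×ˢ Finset.range M, F r.1 r.2 q :=
    Finset.measurable_prod _ fun q _ => hFm q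
  -- With the points frozen at y, the factors depend on distinct uniforms, so the integral of the
  -- product is a product of `thin` values. Independence of points and uniforms then permits Fubini.
  have hinner : ∀ y, ∫⁻ w, ∏ q ∈ Finset.univ ×ˢ Finset.range M, F y w q ∂(P.map W) =
      ∏ q ∈ Finset.univ ×ˢ Finset.range M, (if (q.2 : ℕ∞) < y.1 then
        thin (f (q.1 : Fin n) (y.2 q.2).1) (y.2 q.2).2 else 1) := by
    intro y
    refine (lintegral_map (hprod.comp (measurable_prodMk_left (x := y))) hWm).trans ?_
    let H : Fin n × ℕ → ℝ → ℝ≥0∞ := fun q u =>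
      if (q.2 : ℕ∞) < y.1 ∧ u < (y.2 q.2).2 then f q.1 (y.2 q.2).1 else 1
    have hHm : ∀ q, Measurable (H q) := fun q => by
      refine Measurable.ite ?_ measurable_const measurable_const
      by_cases hq : (q.2 : ℕ∞) < y.1
      · simp only [hq, true_and]; exact measurableSet_Iio
      · simp [hq]
    have hind : iIndepFun (fun (q : Fin n × ℕ) ξ => H q (U q.1 q.2 ξ)) P := by
      have h1 := h.indep_uniform.precomp (g := fun q : Fin n × ℕ => ((q.1 : ℕ), q.2)) (by
        rintro ⟨a, b⟩ ⟨c, d⟩ hh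
        simp only [Prod.mk.injEq] at hh
        exact Prod.ext (Fin.ext hh.1) hh.2)
      exact h1.comp H hHm
    have h2 := lintegral_prod_eq_prod_lintegral_of_indepFun (Finset.univ ×ˢ Finset.range M) _ hind
      fun q => (hHm q).comp (h.measurable_uniform _ _)
    refine h2.trans (Finset.prod_congr rfl fun q _ => ?_)
    have h3 : ∫⁻ ξ, H q (U q.1 q.2 ξ) ∂P = ∫⁻ u, H q u ∂(P.map (U q.1 q.2)) :=
      (lintegral_map (hHm q) (h.measurable_uniform _ _)).symm
    rw [h3, h.uniform]
    by_cases hq : (q.2 : ℕ∞) < y.1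
    · simp only [H, hq, true_and, if_true, thin]
    · simp [H, hq]
  have hmap : P.map (fun ξ => (Y ξ, W ξ)) = (P.map Y).prod (P.map W) :=
    (indepFun_iff_map_prod_eq_prod_map_map hYm.aemeasurable hWm.aemeasurable).1 h.indep_points
  have hpW : IsProbabilityMeasure (P.map W) := Measure.isProbabilityMeasure_map hWm.aemeasurable
  calc _ = ∫⁻ r, ∏ q ∈ Finset.univ ×ˢ Finset.range M, F r.1 r.2 q ∂(P.map fun ξ => (Y ξ, W ξ)) :=
        (lintegral_map hprod (hYm.prodMk hWm)).symm
    _ = ∫⁻ y, ∫⁻ w, ∏ q ∈ Finset.univ ×ˢ Finset.range M, F y w q ∂(P.map W) ∂(P.map Y) := by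
        rw [hmap, lintegral_prod _ hprod.aemeasurable]
    _ = ∫⁻ ξ, ∫⁻ w, ∏ q ∈ Finset.univ ×ˢ Finset.range M, F (Y ξ) w q ∂(P.map W) ∂P :=
        lintegral_map hprod.lintegral_prod_right' hYm
    _ = _ := by simp_rw [hinner]; rfl

/-- The Laplace functional of the first `n` Bernoulli processes. -/
theorem IsBernoulliSampling.lintegral_lap [IsProbabilityMeasure P] [SigmaFinite ν]
    (h : IsBernoulliSampling P N X U ν) {n : ℕ} {f : Fin n → Ω → ℝ≥0∞}
    (hf : ∀ j, Measurable (f j)) :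
    ∫⁻ ξ, lap (∑ j : Fin n, ∫⁻ ω, f j ω ∂(bernoulliProcess N X U j ξ)) ∂P =
      lap (∫⁻ x, 1 - ∏ j, thin (lap (f j x.1)) x.2 ∂ν) := by
  classical
  have hXm := h.poisson.measurable_point
  have hNm := h.poisson.measurable_card
  set g : Ω × ℝ → ℝ≥0∞ := fun x => ∏ j, thin (lap (f j x.1)) x.2 with hg
  have hthin1 : ∀ j ω p, thin (lap (f j ω)) p ≤ 1 := fun j ω p => thin_le_one (lap_le_one _) _
  have hg1 : ∀ x, g x ≤ 1 := fun x => Finset.prod_le_one' fun j _ => hthin1 j _ _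
  have hthinm : ∀ j, Measurable fun x : Ω × ℝ => thin (lap (f j x.1)) x.2 := fun j =>
    measurable_thin.comp ((measurable_lap.comp ((hf j).comp measurable_fst)).prodMk measurable_snd)
  have hgm : Measurable g := Finset.measurable_prod _ fun j _ => hthinm j
  -- The product of g over the points is the exponential of minus a point sum of `negLog` ∘ g; the
  -- value g = 0 is allowed because `negLog` may be ∞.
  have hPois := h.poisson.lintegral_lap_pointSum (measurable_negLog.comp hgm)
  simp only [Function.comp_apply, lap_negLog (hg1 _)] at hPois
  rw [← hPois]
  -- Only finitely many points can be averaged at once. Truncate to the first M points and let M →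
  -- ∞, with all products bounded by 1.
  have hlimL : ∀ ξ, Tendsto (fun M : ℕ => ∏ q ∈ Finset.univ ×ˢ Finset.range M,
      (if (q.2 : ℕ∞) < N ξ ∧ U (q.1 : Fin n) q.2 ξ < (X q.2 ξ).2 then
        lap (f q.1 (X q.2 ξ).1) else 1)) atTop
      (𝓝 (lap (∑ j : Fin n, ∫⁻ ω, f j ω ∂(bernoulliProcess N X U j ξ)))) := by
    intro ξ
    have h1 : Tendsto (fun M : ℕ => ∑ j : Fin n, ∑ k ∈ Finset.range M,
        if (k : ℕ∞) < N ξ ∧ U j k ξ < (X k ξ).2 then f j (X k ξ).1 else 0) atTop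
        (𝓝 (∑ j : Fin n, ∫⁻ ω, f j ω ∂(bernoulliProcess N X U j ξ))) := by
      refine tendsto_finsetSum _ fun j _ => ?_
      rw [lintegral_bernoulliProcess _ _ (hf j)]
      exact ENNReal.tendsto_nat_tsum _
    refine ((continuous_lap.tendsto _).comp h1).congr fun M => ?_
    simp only [Function.comp_apply, lap_sum, Finset.prod_product]
    refine Finset.prod_congr rfl fun j _ => Finset.prod_congr rfl fun k _ => ?_
    split_ifs <;> simp
  have hlimR : ∀ ξ, Tendsto (fun M : ℕ => ∏ q ∈ Finset.univ ×ˢ Finset.range M,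
      (if (q.2 : ℕ∞) < N ξ then thin (lap (f (q.1 : Fin n) (X q.2 ξ).1)) (X q.2 ξ).2 else 1)) atTop
      (𝓝 (lap (pointSum N X (negLog ∘ g) ξ))) := by
    intro ξ
    have h1 : Tendsto (fun M : ℕ => ∑ k ∈ Finset.range M,
        if (k : ℕ∞) < N ξ then negLog (g (X k ξ)) else 0) atTop
        (𝓝 (pointSum N X (negLog ∘ g) ξ)) := ENNReal.tendsto_nat_tsum _
    refine ((continuous_lap.tendsto _).comp h1).congr fun M => ?_
    simp only [Function.comp_apply, lap_sum, Finset.prod_product_right]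
    refine Finset.prod_congr rfl fun k _ => ?_
    split_ifs
    · rw [lap_negLog (hg1 _)]
    · simp
  have hL := tendsto_lintegral_of_dominated_convergence (μ := P) (fun _ => 1) (fun M => ?_)
    (fun M => ae_of_all _ fun ξ => ?_) (by simp) (ae_of_all _ hlimL)
  have hR := tendsto_lintegral_of_dominated_convergence (μ := P) (fun _ => 1) (fun M => ?_)
    (fun M => ae_of_all _ fun ξ => ?_) (by simp) (ae_of_all _ hlimR)
  · refine tendsto_nhds_unique hL (hR.congr fun M => ?_)
    exact (h.lintegral_prod_mark (fun j => measurable_lap.comp (hf j)) M).symm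
  · refine Finset.measurable_prod _ fun q _ => Measurable.ite ?_
      ((hthinm q.1).comp (hXm q.2)) measurable_const
    exact hNm (measurableSet_index_lt q.2)
  · refine Finset.prod_le_one' fun q _ => ?_
    split_ifs
    · exact hthin1 _ _ _
    · exact le_rfl
  · refine Finset.measurable_prod _ fun q _ => Measurable.ite ?_
      (measurable_lap.comp ((hf q.1).comp (measurable_fst.comp (hXm q.2)))) measurable_const
    exact (hNm (measurableSet_index_lt q.2)).inter
      (measurableSet_lt (h.measurable_uniform _ _) (measurable_snd.comp (hXm q.2)))
  · refine Finset.prod_le_one' fun q _ => ?_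
    split_ifs
    · exact lap_le_one _
    · exact le_rfl

end BernoulliSampling

/-! ### Expansion over the set of successful trials. -/

section Subsets

variable {n : ℕ}

theorem sum_finset_eq_add_sum_nonempty {M : Type*} [AddCommMonoid M]
    (F : Finset (Fin n) → M) :
    ∑ H, F H = F ∅ + ∑ H : {s : Finset (Fin n) // s.Nonempty}, F H.1 := by
  classical
  rw [← Finset.add_sum_erase Finset.univ F (Finset.mem_univ ∅)]
  congr 1
  refine (Finset.sum_subtype _ (fun H => ?_) F)
  simp [Finset.nonempty_iff_ne_empty]

/-- The probability that exactly the trials in `H` are successful, out of `n` independent trials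
with success probability `p`. -/
def selectionProb (p : ℝ) (H : Finset (Fin n)) : ℝ≥0∞ :=
  ENNReal.ofReal (p ^ H.card * (1 - p) ^ (n - H.card))

theorem sum_selectionProb {p : ℝ} (hp : p ∈ Ioc (0 : ℝ) 1) :
    ∑ H : Finset (Fin n), selectionProb p H = 1 := by
  have h1 : 0 ≤ 1 - p := sub_nonneg.2 hp.2
  simp_rw [selectionProb]
  rw [← ENNReal.ofReal_sum_of_nonneg fun H _ =>
    mul_nonneg (pow_nonneg hp.1.le _) (pow_nonneg h1 _), Fin.sum_pow_mul_eq_add_pow]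
  simp

theorem prod_thin_eq_sum {p : ℝ} (hp : p ∈ Ioc (0 : ℝ) 1) (e : Fin n → ℝ≥0∞) :
    ∏ j, thin (e j) p = ∑ H, selectionProb p H * ∏ j ∈ H, e j := by
  classical
  have h1 : 0 ≤ 1 - p := sub_nonneg.2 hp.2
  simp_rw [thin_of_mem_Ioc _ hp]
  rw [Fintype.prod_add]
  refine Finset.sum_congr rfl fun H _ => ?_
  rw [Finset.prod_mul_distrib, Finset.prod_const, Finset.prod_const, selectionProb,
    ENNReal.ofReal_mul (pow_nonneg hp.1.le _), ENNReal.ofReal_pow hp.1.le,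
    ENNReal.ofReal_pow h1, Finset.card_compl, Fintype.card_fin]
  ring

/-- The term (1 - p)^n of the empty set cancels pointwise. This has to happen before integration,
since p⁻¹ μ₁(dp) may have infinite mass. The additive form avoids truncated subtraction. -/
theorem one_sub_prod_thin_add {p : ℝ} (hp : p ∈ Ioc (0 : ℝ) 1) {e : Fin n → ℝ≥0∞}
    (he : ∀ j, e j ≤ 1) :
    1 - ∏ j, thin (e j) p +
        ∑ H : {s : Finset (Fin n) // s.Nonempty}, selectionProb p H.1 * ∏ j ∈ H.1, e j =
      ∑ H : {s : Finset (Fin n) // s.Nonempty}, selectionProb p H.1 := by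
  have h1 : ∏ j, thin (e j) p ≤ 1 := Finset.prod_le_one' fun j _ => thin_le_one (he j) p
  have h2 := prod_thin_eq_sum hp e
  have h3 := sum_selectionProb (n := n) hp
  rw [sum_finset_eq_add_sum_nonempty] at h2 h3
  rw [Finset.prod_empty, mul_one] at h2
  have hne : selectionProb p (∅ : Finset (Fin n)) ≠ ∞ := ENNReal.ofReal_ne_top
  rw [← ENNReal.add_right_inj hne, h3, add_left_comm, ← h2]
  exact tsub_add_cancel_of_le h1

/-- `1 - (1 - p) ^ n = p ∑_{j < n} (1 - p) ^ j`, divided by `p`. -/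
theorem sum_nonempty_pow_eq_geom_sum {p : ℝ} (hp : p ≠ 0) :
    ∑ H : {s : Finset (Fin n) // s.Nonempty}, p ^ (H.1.card - 1) * (1 - p) ^ (n - H.1.card) =
      ∑ j ∈ Finset.range n, (1 - p) ^ j := by
  have h1 := Fin.sum_pow_mul_eq_add_pow (n := n) p (1 - p)
  rw [sum_finset_eq_add_sum_nonempty] at h1
  have h2 : ∀ H : {s : Finset (Fin n) // s.Nonempty}, p ^ H.1.card * (1 - p) ^ (n - H.1.card) =
      p * (p ^ (H.1.card - 1) * (1 - p) ^ (n - H.1.card)) := fun H => by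
    have := Finset.card_pos.2 H.2
    rw [← mul_assoc, ← pow_succ', Nat.sub_add_cancel this]
  simp_rw [h2] at h1
  rw [← Finset.mul_sum] at h1
  have h3 := mul_neg_geom_sum (1 - p) n
  simp only [sub_sub_cancel, Finset.card_empty, pow_zero, one_mul, tsub_zero,
    add_sub_cancel, one_pow] at h1 h3
  exact mul_left_cancel₀ hp (by linarith)

end Subsets

/-! ### Integration against the beta intensity. -/

section Intensity

variable {Ξ₀ : Type*} [MeasurableSpace Ξ₀] {P₀ : Measure Ξ₀} [IsProbabilityMeasure P₀]
  {R : Ξ₀ → Setoid ℕ} {α : ℝ} {V : ℕ → ℕ → ℝ} {n : ℕ}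

/-- The weight `(1 - α)_{|H| - 1} Φ_{n - |H|}^{|H|, 1}` of a nonempty set `H` of trials. -/
def setWeight (α : ℝ) (V : ℕ → ℕ → ℝ) (H : {s : Finset (Fin n) // s.Nonempty}) : ℝ :=
  blockWeight α V (H.1.card - 1) (n - H.1.card)

theorem IsGibbsPartition.setWeight_nonneg (hR : IsGibbsPartition P₀ R α V)
    (H : {s : Finset (Fin n) // s.Nonempty}) : 0 ≤ setWeight α V H :=
  hR.blockWeight_nonneg _ _

/-- Both sides are expectations of functions of P₁, which coincide pointwise as (1 - (1 - p)^n) / p;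
this is where P₁ > 0 enters. -/
theorem IsGibbsPartition.sum_setWeight (hR : IsGibbsPartition P₀ R α V)
    (hR₀ : ∀ᵐ ξ ∂P₀, 0 < firstFreq R ξ) :
    ∑ H : {s : Finset (Fin n) // s.Nonempty}, setWeight α V H =
      ∑ j ∈ Finset.Icc 1 n, primitive α V (j - 1) 1 1 := by
  have hint : ∀ a b : ℕ, Integrable (fun ξ => firstFreq R ξ ^ a * (1 - firstFreq R ξ) ^ b) P₀ :=
    hR.integrable_firstFreq
  have h1 : ∑ j ∈ Finset.Icc 1 n, primitive α V (j - 1) 1 1 =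
      ∑ j ∈ Finset.range n, blockWeight α V 0 j := by
    rw [Finset.range_eq_Ico, Finset.sum_Ico_eq_sum_range, ← Finset.Ico_add_one_right_eq_Icc,
      Finset.sum_Ico_eq_sum_range]
    refine Finset.sum_congr (by simp) fun j _ => ?_
    simp [blockWeight]
  rw [h1]
  simp_rw [setWeight, ← hR.integral_firstFreq]
  rw [← integral_finsetSum _ fun H _ => hint _ _, ← integral_finsetSum _ fun H _ => hint _ _]
  refine integral_congr_ae ?_
  filter_upwards [hR₀] with ξ hξ
  rw [sum_nonempty_pow_eq_geom_sum hξ.ne']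
  simp

variable {Ω : Type*} [MeasurableSpace Ω] (B₀ : Measure Ω)

theorem sigmaFinite_betaIntensity [IsFiniteMeasure B₀] (μ : Measure ℝ) [IsFiniteMeasure μ] :
    SigmaFinite (betaIntensity B₀ μ) := by
  have : SigmaFinite ((μ.restrict (Ioc 0 1)).withDensity fun p => ENNReal.ofReal p⁻¹) :=
    SigmaFinite.withDensity_ofReal _
  unfold betaIntensity
  infer_instance

theorem ae_betaIntensity [IsFiniteMeasure B₀] (μ : Measure ℝ) [IsFiniteMeasure μ] :
    ∀ᵐ x ∂betaIntensity B₀ μ, x.2 ∈ Ioc (0 : ℝ) 1 := by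
  have : SigmaFinite ((μ.restrict (Ioc 0 1)).withDensity fun p => ENNReal.ofReal p⁻¹) :=
    SigmaFinite.withDensity_ofReal _
  refine Measure.quasiMeasurePreserving_snd.ae (p := fun p => p ∈ Ioc (0 : ℝ) 1) ?_
  exact (withDensity_absolutelyContinuous _ _).ae_le (ae_restrict_mem measurableSet_Ioc)

theorem IsGibbsPartition.isProbabilityMeasure_structuralDist (hR : IsGibbsPartition P₀ R α V) :
    IsProbabilityMeasure (structuralDist P₀ R) :=
  Measure.isProbabilityMeasure_map hR.aemeasurable_firstFreq

theorem measurable_selectionProb (H : Finset (Fin n)) : Measurable fun p => selectionProb p H := by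
  unfold selectionProb
  fun_prop

/-- Since H is nonempty, one factor p cancels the density p⁻¹ and leaves the moment of μ₁ with
exponents |H| - 1 and n - |H|. -/
theorem IsGibbsPartition.lintegral_selectionProb [IsFiniteMeasure B₀]
    (hR : IsGibbsPartition P₀ R α V) (hR₀ : ∀ᵐ ξ ∂P₀, 0 < firstFreq R ξ)
    (H : {s : Finset (Fin n) // s.Nonempty}) {F : Ω → ℝ≥0∞} (hF : Measurable F) :
    ∫⁻ x, selectionProb x.2 H.1 * F x.1 ∂betaIntensity B₀ (structuralDist P₀ R) =
      ENNReal.ofReal (setWeight α V H) * ∫⁻ ω, F ω ∂B₀ := by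
  have := hR.isProbabilityMeasure_structuralDist
  have hae := hR.ae_structuralDist hR₀
  rw [betaIntensity, Measure.restrict_eq_self_of_ae_mem hae]
  simp_rw [mul_comm (selectionProb _ _)]
  rw [lintegral_prod_mul hF.aemeasurable (measurable_selectionProb _).aemeasurable, mul_comm,
    lintegral_withDensity_eq_lintegral_mul _ (by fun_prop) (measurable_selectionProb _)]
  congr 1
  rw [setWeight, ← hR.lintegral_structuralDist]
  refine lintegral_congr_ae ?_
  filter_upwards [hae] with p hp
  have h1 := Finset.card_pos.2 H.2
  rw [Pi.mul_apply, selectionProb, ← ENNReal.ofReal_mul (inv_nonneg.2 hp.1.le)]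
  congr 1
  obtain ⟨m, hm⟩ : ∃ m, H.1.card = m + 1 := ⟨H.1.card - 1, by omega⟩
  rw [hm, Nat.add_sub_cancel, pow_succ]
  have := hp.1.ne'
  field_simp

/-- The Laplace exponent of the first `n` Bernoulli processes. -/
theorem IsGibbsPartition.lintegral_one_sub_prod_thin [IsFiniteMeasure B₀]
    (hR : IsGibbsPartition P₀ R α V) (hR₀ : ∀ᵐ ξ ∂P₀, 0 < firstFreq R ξ)
    {e : Fin n → Ω → ℝ≥0∞} (he : ∀ j, Measurable (e j)) (he1 : ∀ j ω, e j ω ≤ 1) :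
    ∫⁻ x, 1 - ∏ j, thin (e j x.1) x.2 ∂betaIntensity B₀ (structuralDist P₀ R) +
        ∑ H : {s : Finset (Fin n) // s.Nonempty},
          ENNReal.ofReal (setWeight α V H) * ∫⁻ ω, ∏ j ∈ H.1, e j ω ∂B₀ =
      ENNReal.ofReal (∑ H : {s : Finset (Fin n) // s.Nonempty}, setWeight α V H) *
        B₀ univ := by
  have := hR.isProbabilityMeasure_structuralDist
  have hprod : ∀ H : Finset (Fin n), Measurable fun ω => ∏ j ∈ H, e j ω := fun H =>
    Finset.measurable_prod _ fun j _ => he j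
  have hsel : ∀ H : Finset (Fin n), Measurable fun x : Ω × ℝ => selectionProb x.2 H := fun H =>
    (measurable_selectionProb H).comp measurable_snd
  have hselprod : ∀ H : Finset (Fin n), Measurable fun x : Ω × ℝ =>
      selectionProb x.2 H * ∏ j ∈ H, e j x.1 := fun H =>
    (hsel H).mul ((hprod H).comp measurable_fst)
  simp_rw [← hR.lintegral_selectionProb B₀ hR₀ _ (hprod _)]
  rw [← lintegral_finsetSum _ fun H _ => hselprod H.1,
    ← lintegral_add_right _ (Finset.measurable_sum _ fun H _ => hselprod H.1),
    ENNReal.ofReal_sum_of_nonneg fun H _ => hR.setWeight_nonneg H, Finset.sum_mul]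
  have h1 : ∀ H : {s : Finset (Fin n) // s.Nonempty},
      ENNReal.ofReal (setWeight α V H) * B₀ univ =
        ∫⁻ x, selectionProb x.2 H.1 ∂betaIntensity B₀ (structuralDist P₀ R) := by
    intro H
    have := hR.lintegral_selectionProb B₀ hR₀ H (F := fun _ => 1) measurable_const
    simpa using this.symm
  simp_rw [h1]
  rw [← lintegral_finsetSum _ fun H _ => hsel H.1]
  refine lintegral_congr_ae ?_
  filter_upwards [ae_betaIntensity B₀ (structuralDist P₀ R)] with x hx
  exact one_sub_prod_thin_add hx fun j => he1 j x.1

end Intensity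

/-! ### Configurations of labelled atoms. -/

section Configuration

variable {Ω : Type*} [MeasurableSpace Ω] {n K : ℕ}

theorem measurable_configuration (h : Fin K → {s : Finset (Fin n) // s.Nonempty}) :
    Measurable (configuration (Ω := Ω) h) := by
  classical
  refine measurable_pi_lambda _ fun j => ?_
  refine Measure.measurable_of_measurable_coe _ fun A hA => ?_
  simp only [configuration, Measure.coe_finsetSum, Finset.sum_apply]
  refine Finset.measurable_sum _ fun k _ => ?_
  split_ifs
  · exact (Measure.measurable_coe hA).comp (Measure.measurable_dirac.comp (measurable_pi_apply k))
  · exact measurable_const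

open Classical in
theorem lintegral_configuration (h : Fin K → {s : Finset (Fin n) // s.Nonempty}) (x : Fin K → Ω)
    (j : Fin n) {f : Ω → ℝ≥0∞} (hf : Measurable f) :
    ∫⁻ ω, f ω ∂configuration h x j = ∑ k, if j ∈ (h k).1 then f (x k) else 0 := by
  rw [configuration, lintegral_finsetSum_measure]
  refine Finset.sum_congr rfl fun k _ => ?_
  split_ifs
  · rw [lintegral_dirac' _ hf]
  · simp

/-- Exchanging the sums over trials and atoms gives one factor per atom, as needed for integration
against a product measure. -/
theorem lap_sum_lintegral_configuration (h : Fin K → {s : Finset (Fin n) // s.Nonempty})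
    (x : Fin K → Ω) {f : Fin n → Ω → ℝ≥0∞} (hf : ∀ j, Measurable (f j)) :
    lap (∑ j, ∫⁻ ω, f j ω ∂configuration h x j) = ∏ k, ∏ j ∈ (h k).1, lap (f j (x k)) := by
  classical
  simp_rw [fun j => lintegral_configuration h x j (hf j)]
  rw [Finset.sum_comm, lap_sum]
  refine Finset.prod_congr rfl fun k _ => ?_
  rw [← Finset.sum_filter, lap_sum]
  simp

variable [MeasurableSingletonClass Ω]

open Classical in
theorem configuration_singleton (h : Fin K → {s : Finset (Fin n) // s.Nonempty})
    (x : Fin K → Ω) (j : Fin n) (ω : Ω) :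
    configuration h x j {ω} = ∑ k, if j ∈ (h k).1 ∧ x k = ω then 1 else 0 := by
  simp only [configuration, Measure.coe_finsetSum, Finset.sum_apply]
  refine Finset.sum_congr rfl fun k _ => ?_
  by_cases h1 : j ∈ (h k).1 <;> by_cases h2 : x k = ω <;> simp [h1, h2]

theorem atoms_configuration (h : Fin K → {s : Finset (Fin n) // s.Nonempty})
    (x : Fin K → Ω) : atoms (configuration h x) = range x := by
  classical
  ext ω
  simp only [atoms, mem_ofPred_eq, configuration_singleton, mem_range]
  constructor
  · rintro ⟨j, hj⟩
    by_contra hcon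
    push Not at hcon
    exact hj (Finset.sum_eq_zero fun k _ => by simp [hcon k])
  · rintro ⟨k, rfl⟩
    obtain ⟨j, hj⟩ := (h k).2
    refine ⟨j, fun h0 => ?_⟩
    have := Finset.sum_eq_zero_iff.1 h0 k (Finset.mem_univ k)
    simp [hj] at this

theorem atomCount_configuration (h : Fin K → {s : Finset (Fin n) // s.Nonempty})
    {x : Fin K → Ω} (hx : Function.Injective x) (k : Fin K) :
    atomCount (configuration h x) (x k) = (h k).1.card := by
  classical
  have h1 : ∀ j, (configuration h x j).real {x k} = if j ∈ (h k).1 then 1 else 0 := by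
    intro j
    rw [measureReal_def, configuration_singleton, Finset.sum_eq_single k]
    · by_cases hj : j ∈ (h k).1 <;> simp [hj]
    · intro k' _ hk'
      rw [if_neg fun hh => hk' (hx hh.2)]
    · simp
  rw [atomCount]
  simp_rw [h1]
  simp

/-- For distinct positions the labels biject with the atoms and S_k = |h k|. Coinciding positions
would merge atoms and change both. -/
theorem productDensity_configuration (α : ℝ) (V : ℕ → ℕ → ℝ) (γ : ℝ)
    (h : Fin K → {s : Finset (Fin n) // s.Nonempty}) {x : Fin K → Ω}
    (hx : Function.Injective x) :
    productDensity α V γ (configuration h x) =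
      Real.exp (-γ * ∑ j ∈ Finset.Icc 1 n, primitive α V (j - 1) 1 1) *
        ∏ k, γ * setWeight α V (h k) := by
  have hc : (range x).ncard = K := by
    rw [← image_univ, ncard_image_of_injective _ hx]
    simp
  rw [productDensity, atoms_configuration, finprod_mem_range hx, finprod_eq_prod_of_fintype, hc]
  simp_rw [atomCount_configuration h hx]
  have h1 : ∀ k, rising (1 - α) ((h k).1.card - 1) *
      primitive α V (n - (h k).1.card) (h k).1.card 1 = setWeight α V (h k) := fun k => by
    have := Finset.card_pos.2 (h k).2
    rw [setWeight, blockWeight, Nat.sub_add_cancel this]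
  simp_rw [h1]
  rw [Finset.prod_mul_distrib, Finset.prod_const, Finset.card_univ, Fintype.card_fin]
  ring

end Configuration

/-! ### Independent positions from a non-atomic law. -/

section Pi

variable {Ω : Type*} [MeasurableSpace Ω] {K : ℕ} (Q : Measure Ω) [IsProbabilityMeasure Q]

theorem lintegral_pi_prod {F : Fin K → Ω → ℝ≥0∞} (hF : ∀ k, Measurable (F k)) :
    ∫⁻ x, ∏ k, F k (x k) ∂(Measure.pi fun _ : Fin K => Q) = ∏ k, ∫⁻ ω, F k ω ∂Q := by
  have h1 : iIndepFun (fun (k : Fin K) (x : Fin K → Ω) => F k (x k))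
      (Measure.pi fun _ : Fin K => Q) := iIndepFun_pi fun k => (hF k).aemeasurable
  refine (lintegral_prod_eq_prod_lintegral_of_indepFun Finset.univ _ h1
    fun k => (hF k).comp (measurable_pi_apply k)).trans (Finset.prod_congr rfl fun k _ => ?_)
  exact (measurePreserving_eval (fun _ : Fin K => Q) k).lintegral_comp (hF k)

/-- Each diagonal x i = x j is null by Fubini, its sections being singletons. -/
theorem ae_pi_injective [MeasurableEq Ω] [NullSingletonClass Q] :
    ∀ᵐ x ∂(Measure.pi fun _ : Fin K => Q), Function.Injective x := by
  have h : ∀ i j : Fin K, i ≠ j → ∀ᵐ x ∂(Measure.pi fun _ : Fin K => Q), x i ≠ x j := by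
    intro i j hij
    obtain ⟨K, rfl⟩ : ∃ K', K = K' + 1 := ⟨K - 1, by have := i.2; omega⟩
    obtain ⟨j', rfl⟩ := Fin.exists_succAbove_eq hij.symm
    have hmp := measurePreserving_piFinSuccAbove (fun _ : Fin (K + 1) => Q) i
    have hset : MeasurableSet {q : Ω × (Fin K → Ω) | q.1 = q.2 j'} :=
      measurableSet_eq_fun (g := fun q : Ω × (Fin K → Ω) => q.2 j') measurable_fst
        ((measurable_pi_apply j').comp measurable_snd)
    have h0 : (Q.prod (Measure.pi fun _ : Fin K => Q)) {q | q.1 = q.2 j'} = 0 := by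
      rw [Measure.prod_apply_symm hset]
      refine lintegral_eq_zero_of_ae_eq_zero (ae_of_all _ fun y => ?_)
      exact measure_singleton (y j')
    have h1 : ∀ᵐ q ∂(Q.prod (Measure.pi fun _ : Fin K => Q)), q.1 ≠ q.2 j' :=
      measure_eq_zero_iff_ae_notMem.1 h0
    exact hmp.quasiMeasurePreserving.ae h1
  have h2 : ∀ᵐ x ∂(Measure.pi fun _ : Fin K => Q), ∀ i j : Fin K, i ≠ j → x i ≠ x j := by
    simp only [ae_all_iff, eventually_imp_distrib_left]
    exact h
  filter_upwards [h2] with x hx i j hij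
  by_contra hne
  exact hx i j hne hij

end Pi

/-! ### Uniqueness of Laplace functionals. -/

theorem lap_injective : Function.Injective lap := fun x y h => by
  have h1 := EReal.exp_strictMono.injective h
  exact_mod_cast neg_injective h1

section LaplaceUniqueness

variable {I : Type*} [Fintype I]

theorem continuous_lap_sum (c : I → ℕ) :
    Continuous fun y : I → ℝ≥0∞ => (lap (∑ i, c i * y i)).toReal := by
  refine ENNReal.continuousOn_toReal.comp_continuous (continuous_lap.comp ?_)
    fun y => lap_ne_top _
  exact continuous_finsetSum _ fun i _ =>
    (ENNReal.continuous_const_mul (ENNReal.natCast_ne_top _)).comp (continuous_apply i)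

/-- The function `y ↦ exp (-∑ i, c i * y i)` on `[0, ∞]^I`. -/
def lapBCF (c : I → ℕ) : BoundedContinuousFunction (I → ℝ≥0∞) ℝ :=
  BoundedContinuousFunction.ofNormedAddCommGroup
    (fun y => (lap (∑ i, c i * y i)).toReal) (continuous_lap_sum c) 1 fun y => by
      rw [Real.norm_of_nonneg ENNReal.toReal_nonneg]
      exact ENNReal.toReal_le_of_le_ofReal zero_le_one (by simpa using lap_le_one _)

@[simp]
theorem lapBCF_apply (c : I → ℕ) (y : I → ℝ≥0∞) :
    lapBCF c y = (lap (∑ i, c i * y i)).toReal := rfl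

variable (I) in
/-- The multiplicative monoid of the functions `y ↦ exp (-∑ i, c i * y i)`. -/
def lapSubmonoid : Submonoid (BoundedContinuousFunction (I → ℝ≥0∞) ℝ) where
  carrier := range lapBCF
  one_mem' := ⟨0, by ext; simp⟩
  mul_mem' := by
    rintro _ _ ⟨c, rfl⟩ ⟨d, rfl⟩
    refine ⟨c + d, ?_⟩
    ext y
    simp [add_mul, Finset.sum_add_distrib, lap_add]

variable (I) in
/-- The star subalgebra generated by the functions `y ↦ exp (-∑ i, c i * y i)`. -/
def lapSubalgebra : StarSubalgebra ℝ (BoundedContinuousFunction (I → ℝ≥0∞) ℝ) where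
  toSubalgebra := Algebra.adjoin ℝ
    (lapSubmonoid I : Set (BoundedContinuousFunction (I → ℝ≥0∞) ℝ))
  star_mem' := fun {a} ha => by
    have : star a = a := by ext; simp
    rwa [this]

/-- The generators are closed under multiplication, so the algebra is their linear span, and
equality of integrals extends to it by linearity. -/
theorem mem_lapSubalgebra {g : BoundedContinuousFunction (I → ℝ≥0∞) ℝ} :
    g ∈ lapSubalgebra I ↔ g ∈ Submodule.span ℝ (range (lapBCF (I := I))) := by
  have h := Algebra.adjoin_eq_span ℝ
    (lapSubmonoid I : Set (BoundedContinuousFunction (I → ℝ≥0∞) ℝ))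
  rw [Submonoid.closure_eq] at h
  change g ∈ Subalgebra.toSubmodule (Algebra.adjoin ℝ
    (lapSubmonoid I : Set (BoundedContinuousFunction (I → ℝ≥0∞) ℝ))) ↔ _
  rw [h]
  rfl

theorem lapBCF_mem_lapSubalgebra (c : I → ℕ) : lapBCF c ∈ lapSubalgebra I :=
  mem_lapSubalgebra.2 (Submodule.subset_span ⟨c, rfl⟩)

theorem exists_lapBCF_ne {y y' : I → ℝ≥0∞} (hy : y ≠ y') : ∃ c, lapBCF c y ≠ lapBCF c y' := by
  classical
  obtain ⟨i, hi⟩ := Function.ne_iff.1 hy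
  have h1 : ∀ y : I → ℝ≥0∞, lapBCF (Pi.single i 1) y = (lap (y i)).toReal := fun y => by
    rw [lapBCF_apply, Finset.sum_eq_single i]
    · simp
    · intro j _ hj
      simp [hj]
    · simp
  refine ⟨Pi.single i 1, ?_⟩
  rw [h1, h1]
  intro h
  exact hi (lap_injective ((ENNReal.toReal_eq_toReal_iff' (lap_ne_top _) (lap_ne_top _)).1 h))

theorem separatesPoints_lapSubalgebra :
    ((lapSubalgebra I).map
      (BoundedContinuousFunction.toContinuousMapStarₐ ℝ)).SeparatesPoints := by
  intro y y' hy
  obtain ⟨c, hc⟩ := exists_lapBCF_ne hy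
  use lapBCF c
  simp only [StarSubalgebra.coe_toSubalgebra, StarSubalgebra.coe_map, Set.mem_image,
    SetLike.mem_coe, exists_exists_and_eq_and, ne_eq]
  exact ⟨⟨lapBCF c, lapBCF_mem_lapSubalgebra c, rfl⟩, hc⟩

/-- A finite measure on `[0, ∞]^I` is determined by its Laplace transform. -/
theorem ext_of_lintegral_lap {μ ν : Measure (I → ℝ≥0∞)} [IsFiniteMeasure μ] [IsFiniteMeasure ν]
    (h : ∀ c : I → ℕ, ∫⁻ y, lap (∑ i, c i * y i) ∂μ = ∫⁻ y, lap (∑ i, c i * y i) ∂ν) :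
    μ = ν := by
  have key : ∀ g ∈ Submodule.span ℝ (range (lapBCF (I := I))), ∫ y, g y ∂μ = ∫ y, g y ∂ν := by
    intro g hg
    induction hg using Submodule.span_induction with
    | mem g hg =>
      obtain ⟨c, rfl⟩ := hg
      have hm : Measurable fun y : I → ℝ≥0∞ => lap (∑ i, c i * y i) := by fun_prop
      have hfin : ∀ y : I → ℝ≥0∞, lap (∑ i, c i * y i) < ∞ := fun y =>
        (lap_ne_top _).lt_top
      simp only [lapBCF_apply]
      rw [integral_toReal hm.aemeasurable (ae_of_all _ hfin),
        integral_toReal hm.aemeasurable (ae_of_all _ hfin), h c]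
    | zero => simp
    | add f g _ _ hf hg =>
      simp only [BoundedContinuousFunction.coe_add, Pi.add_apply]
      rw [integral_add (f.integrable μ) (g.integrable μ),
        integral_add (f.integrable ν) (g.integrable ν), hf, hg]
    | smul a f _ hf =>
      simp only [BoundedContinuousFunction.coe_smul, smul_eq_mul]
      rw [integral_const_mul, integral_const_mul, hf]
  exact ext_of_forall_mem_subalgebra_integral_eq_of_polish
    (separatesPoints_lapSubalgebra (I := I)) fun g hg => key g (mem_lapSubalgebra.1 hg)

variable {Ω : Type*} [MeasurableSpace Ω] {n : ℕ}

/-- The values of the measures `z_1, …, z_n` at the measurable sets. -/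
def evalMeasures (z : Fin n → Measure Ω) (q : Fin n × {A : Set Ω // MeasurableSet A}) : ℝ≥0∞ :=
  z q.1 q.2.1

theorem measurable_evalMeasures : Measurable (evalMeasures (Ω := Ω) (n := n)) :=
  measurable_pi_lambda _ fun q => (Measure.measurable_coe q.2.2).comp (measurable_pi_apply q.1)

/-- The σ-algebra on tuples of measures is generated by the evaluations, so a law is determined by
its image under `evalMeasures`. -/
theorem exists_preimage_evalMeasures_eq {S : Set (Fin n → Measure Ω)} (hS : MeasurableSet S) :
    ∃ B, MeasurableSet B ∧ evalMeasures ⁻¹' B = S := by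
  have h : @Measurable _ _ (MeasurableSpace.comap (evalMeasures (Ω := Ω) (n := n)) inferInstance) _
      (id : (Fin n → Measure Ω) → Fin n → Measure Ω) := by
    refine @measurable_pi_lambda _ _ _ (MeasurableSpace.comap evalMeasures inferInstance) _ _
      fun j => ?_
    refine @Measure.measurable_of_measurable_coe _ _ _
      (MeasurableSpace.comap evalMeasures inferInstance) _ fun A hA => ?_
    exact (measurable_pi_apply (X := fun _ : Fin n × {A : Set Ω // MeasurableSet A} => ℝ≥0∞)
      (j, ⟨A, hA⟩)).comp (comap_measurable evalMeasures)
  exact h hS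

/-- The law of an `n`-tuple of random measures is determined by its Laplace functional. -/
theorem ext_of_lintegral_lap_measures {μ ν : Measure (Fin n → Measure Ω)} [IsFiniteMeasure μ]
    [IsFiniteMeasure ν]
    (h : ∀ f : Fin n → Ω → ℝ≥0∞, (∀ j, Measurable (f j)) →
      ∫⁻ z, lap (∑ j, ∫⁻ ω, f j ω ∂z j) ∂μ = ∫⁻ z, lap (∑ j, ∫⁻ ω, f j ω ∂z j) ∂ν) :
    μ = ν := by
  classical
  have key : ∀ I : Finset (Fin n × {A : Set Ω // MeasurableSet A}),
      (μ.map evalMeasures).map I.restrict = (ν.map evalMeasures).map I.restrict := by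
    intro I
    refine ext_of_lintegral_lap fun c => ?_
    have hm : Measurable fun y : I → ℝ≥0∞ => lap (∑ i, c i * y i) := by fun_prop
    have hmap : ∀ ρ : Measure (Fin n → Measure Ω),
        ∫⁻ y, lap (∑ i, c i * y i) ∂(ρ.map evalMeasures).map I.restrict =
          ∫⁻ z, lap (∑ i : I, c i * I.restrict (evalMeasures z) i) ∂ρ := fun ρ => by
      rw [lintegral_map hm (Finset.measurable_restrict I)]
      exact lintegral_map (hm.comp (Finset.measurable_restrict I)) measurable_evalMeasures
    rw [hmap, hmap]
    -- Weighted indicators chosen so that ∑_j ∫ f_j dz_j is the given linear combination of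
    -- evaluations.
    let f : Fin n → Ω → ℝ≥0∞ := fun j ω =>
      ∑ i : I, if i.1.1 = j then (i.1.2.1).indicator (fun _ => (c i : ℝ≥0∞)) ω else 0
    have hfi : ∀ (j : Fin n) (i : I), Measurable fun ω =>
        if i.1.1 = j then (i.1.2.1).indicator (fun _ => (c i : ℝ≥0∞)) ω else 0 := fun j i => by
      split_ifs
      · exact measurable_const.indicator i.1.2.2
      · exact measurable_const
    have hf : ∀ j, Measurable (f j) := fun j => Finset.measurable_sum _ fun i _ => hfi j i
    have h1 : ∀ z : Fin n → Measure Ω, ∑ j, ∫⁻ ω, f j ω ∂z j =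
        ∑ i : I, c i * I.restrict (evalMeasures z) i := by
      intro z
      have h2 : ∀ j, ∫⁻ ω, f j ω ∂z j =
          ∑ i : I, if i.1.1 = j then c i * I.restrict (evalMeasures z) i else 0 := by
        intro j
        rw [lintegral_finsetSum _ fun i _ => hfi j i]
        refine Finset.sum_congr rfl fun i _ => ?_
        split_ifs with hij
        · rw [lintegral_indicator_const i.1.2.2, ← hij]
          rfl
        · simp
      simp_rw [h2]
      rw [Finset.sum_comm]
      simp
    have h3 := h f hf
    simp_rw [h1] at h3
    exact h3
  -- The index set may be uncountable, but finite-dimensional marginals determine a finite measure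
  -- on the product σ-algebra.
  have hmap : μ.map evalMeasures = ν.map evalMeasures :=
    IsProjectiveLimit.unique (P := fun I => (ν.map evalMeasures).map I.restrict)
      (fun I => key I) fun I => rfl
  ext S hS
  obtain ⟨B, hB, rfl⟩ := exists_preimage_evalMeasures_eq hS
  rw [← Measure.map_apply measurable_evalMeasures hB, hmap,
    Measure.map_apply measurable_evalMeasures hB]

end LaplaceUniqueness

/-! ### The Laplace functional of the product density. -/

section LawOfDensity

variable {Ω : Type*} [MeasurableSpace Ω] {n : ℕ}

theorem tsum_inv_factorial_mul_pow {x : ℝ≥0∞} (hx : x ≠ ∞) :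
    ∑' K : ℕ, (K ! : ℝ≥0∞)⁻¹ * x ^ K = ENNReal.ofReal (Real.exp x.toReal) := by
  have h1 := NormedSpace.expSeries_div_hasSum_exp x.toReal
  rw [← Real.exp_eq_exp_ℝ] at h1
  rw [← h1.tsum_eq, ENNReal.ofReal_tsum_of_nonneg (fun K => by positivity) h1.summable]
  refine tsum_congr fun K => ?_
  rw [ENNReal.ofReal_div_of_pos (by positivity), ENNReal.ofReal_pow ENNReal.toReal_nonneg,
    ENNReal.ofReal_toReal hx, ENNReal.ofReal_natCast, ENNReal.div_eq_inv_mul]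

variable [MeasurableEq Ω] [MeasurableSingletonClass Ω] (B₀ : Measure Ω) [IsFiniteMeasure B₀]
  [NullSingletonClass B₀]

/-- The Laplace functional of the law with the product density. -/
theorem lintegral_lap_lawOfDensity (hB₀ : B₀ ≠ 0) (α : ℝ) (V : ℕ → ℕ → ℝ)
    (hw : ∀ H : {s : Finset (Fin n) // s.Nonempty}, 0 ≤ setWeight α V H)
    {f : Fin n → Ω → ℝ≥0∞} (hf : ∀ j, Measurable (f j)) :
    ∫⁻ z, lap (∑ j, ∫⁻ ω, f j ω ∂z j)
        ∂lawOfDensity ((B₀ univ)⁻¹ • B₀) (productDensity α V (B₀.real univ)) =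
      ENNReal.ofReal (Real.exp (-B₀.real univ *
        ∑ j ∈ Finset.Icc 1 n, primitive α V (j - 1) 1 1)) *
      ENNReal.ofReal (Real.exp (∑ H : {s : Finset (Fin n) // s.Nonempty},
        ENNReal.ofReal (setWeight α V H) * ∫⁻ ω, ∏ j ∈ H.1, lap (f j ω) ∂B₀).toReal) := by
  classical
  set Q := (B₀ univ)⁻¹ • B₀ with hQ
  have hu0 : B₀ univ ≠ 0 := by simpa using hB₀
  have hut : B₀ univ ≠ ∞ := measure_ne_top _ _
  have hQprob : IsProbabilityMeasure Q := ⟨by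
    rw [hQ, Measure.smul_apply, smul_eq_mul, ENNReal.inv_mul_cancel hu0 hut]⟩
  have hQnull : NullSingletonClass Q := ⟨fun x => by
    rw [hQ, Measure.smul_apply, measure_singleton, smul_zero]⟩
  set γ := B₀.real univ with hγ
  set C := Real.exp (-γ * ∑ j ∈ Finset.Icc 1 n, primitive α V (j - 1) 1 1) with hC
  set a : {s : Finset (Fin n) // s.Nonempty} → ℝ≥0∞ := fun H =>
    ENNReal.ofReal (setWeight α V H) * ∫⁻ ω, ∏ j ∈ H.1, lap (f j ω) ∂B₀ with ha
  have hEm : ∀ H : Finset (Fin n), Measurable fun ω => ∏ j ∈ H, lap (f j ω) := fun H =>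
    Finset.measurable_prod _ fun j _ => measurable_lap.comp (hf j)
  have hE1 : ∀ (H : Finset (Fin n)) ω, ∏ j ∈ H, lap (f j ω) ≤ 1 := fun H ω =>
    Finset.prod_le_one' fun j _ => lap_le_one _
  have hat : ∀ H, a H ≠ ∞ := fun H => by
    refine ENNReal.mul_ne_top ENNReal.ofReal_ne_top
      (ne_top_of_le_ne_top hut ((lintegral_mono fun ω => hE1 H.1 ω).trans ?_))
    simp
  have hLm : Measurable fun z : Fin n → Measure Ω => lap (∑ j, ∫⁻ ω, f j ω ∂z j) :=
    measurable_lap.comp (Finset.measurable_sum _ fun j _ =>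
      (Measure.measurable_lintegral (hf j)).comp (measurable_pi_apply j))
  -- Almost surely the positions are distinct and the density is the constant C ∏_k γ w_{h k}. The
  -- factor γ turns Q back into B₀ for each atom.
  have hterm : ∀ (K : ℕ) (h : Fin K → {s : Finset (Fin n) // s.Nonempty}),
      ∫⁻ z, lap (∑ j, ∫⁻ ω, f j ω ∂z j) ∂((Measure.pi fun _ : Fin K => Q).withDensity
        fun x => ENNReal.ofReal (productDensity α V γ (configuration h x))).map
          (configuration h) = ENNReal.ofReal C * ∏ k, a (h k) := by
    intro K h
    have hae : (fun x => ENNReal.ofReal (productDensity α V γ (configuration h x)))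
        =ᵐ[Measure.pi fun _ : Fin K => Q]
        fun _ => ENNReal.ofReal C * ∏ k, ENNReal.ofReal (γ * setWeight α V (h k)) := by
      filter_upwards [ae_pi_injective Q] with x hx
      rw [productDensity_configuration α V γ h hx, ENNReal.ofReal_mul (Real.exp_pos _).le,
        ENNReal.ofReal_prod_of_nonneg fun k _ => mul_nonneg measureReal_nonneg (hw _)]
    rw [lintegral_map hLm (measurable_configuration h), withDensity_congr_ae hae,
      withDensity_const, lintegral_smul_measure, smul_eq_mul, mul_assoc]
    simp_rw [lap_sum_lintegral_configuration h _ hf]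
    rw [lintegral_pi_prod Q fun k => hEm (h k).1, ← Finset.prod_mul_distrib]
    congr 1
    refine Finset.prod_congr rfl fun k _ => ?_
    rw [ha, hQ, lintegral_smul_measure, smul_eq_mul, ENNReal.ofReal_mul measureReal_nonneg,
      ofReal_measureReal]
    have : B₀ univ * (B₀ univ)⁻¹ = 1 := ENNReal.mul_inv_cancel hu0 hut
    calc _ = (B₀ univ * (B₀ univ)⁻¹) * (ENNReal.ofReal (setWeight α V (h k)) *
          ∫⁻ ω, ∏ j ∈ (h k).1, lap (f j ω) ∂B₀) := by ring
      _ = _ := by rw [this, one_mul]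
  rw [lawOfDensity, lintegral_sum_measure]
  -- Summing ∏_k a (h k) over all h gives (∑_H a H)^K; with 1 / K! this is the exponential series.
  simp_rw [lintegral_smul_measure, lintegral_sum_measure, hterm, tsum_fintype, ← Finset.mul_sum,
    ← Fintype.sum_pow, smul_eq_mul, mul_left_comm _ (ENNReal.ofReal C)]
  rw [ENNReal.tsum_mul_left, tsum_inv_factorial_mul_pow]
  exact ENNReal.sum_ne_top.2 fun H _ => hat H

end LawOfDensity

end GibbsIBP

end

/-! ### Comparison of the two Laplace functionals. -/

theorem mainTheorem1
    {Ξ₀ : Type*} [MeasurableSpace Ξ₀] (P₀ : MeasureTheory.Measure Ξ₀)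
    [MeasureTheory.IsProbabilityMeasure P₀] (R : Ξ₀ → Setoid ℕ) (α : ℝ) (V : ℕ → ℕ → ℝ)
    (hR : GibbsIBP.IsGibbsPartition P₀ R α V)
    (hR₀ : ∀ᵐ ξ ∂P₀, 0 < GibbsIBP.firstFreq R ξ)
    {Ω : Type*} [TopologicalSpace Ω] [PolishSpace Ω] [MeasurableSpace Ω] [BorelSpace Ω]
    (B₀ : MeasureTheory.Measure Ω) [MeasureTheory.IsFiniteMeasure B₀]
    [MeasureTheory.NullSingletonClass B₀] (hB₀ : B₀ ≠ 0)
    {Ξ : Type*} [MeasurableSpace Ξ] (P : MeasureTheory.Measure Ξ)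
    [MeasureTheory.IsProbabilityMeasure P]
    (N : Ξ → ℕ∞) (X : ℕ → Ξ → Ω × ℝ) (U : ℕ → ℕ → Ξ → ℝ)
    (hZ : GibbsIBP.IsBernoulliSampling P N X U
      (GibbsIBP.betaIntensity B₀ (GibbsIBP.structuralDist P₀ R)))
    (n : ℕ) :
    ProbabilityTheory.HasLaw
      (fun ξ (j : Fin n) => GibbsIBP.bernoulliProcess N X U j ξ)
      (GibbsIBP.lawOfDensity ((B₀ Set.univ)⁻¹ • B₀)
        (GibbsIBP.productDensity α V (B₀.real Set.univ)))
      P := by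
  open GibbsIBP MeasureTheory in
  have hμ := hR.isProbabilityMeasure_structuralDist
  have hν := sigmaFinite_betaIntensity B₀ (structuralDist P₀ R)
  have hZm : Measurable fun ξ (j : Fin n) => bernoulliProcess N X U j ξ :=
    measurable_pi_lambda _ fun j => hZ.measurable_bernoulliProcess j
  have hLaw : ∀ f : Fin n → Ω → ENNReal, (∀ j, Measurable (f j)) →
      ∫⁻ z, lap (∑ j, ∫⁻ ω, f j ω ∂z j)
        ∂(P.map fun ξ (j : Fin n) => bernoulliProcess N X U j ξ) =
      ∫⁻ z, lap (∑ j, ∫⁻ ω, f j ω ∂z j)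
        ∂lawOfDensity ((B₀ Set.univ)⁻¹ • B₀) (productDensity α V (B₀.real Set.univ)) := by
    intro f hf
    have hLm : Measurable fun z : Fin n → Measure Ω => lap (∑ j, ∫⁻ ω, f j ω ∂z j) :=
      measurable_lap.comp (Finset.measurable_sum _ fun j _ =>
        (Measure.measurable_lintegral (hf j)).comp (measurable_pi_apply j))
    rw [lintegral_map hLm hZm, hZ.lintegral_lap hf,
      lintegral_lap_lawOfDensity B₀ hB₀ α V hR.setWeight_nonneg hf]
    have hexp := hR.lintegral_one_sub_prod_thin B₀ hR₀
      (fun j => measurable_lap.comp (hf j)) (fun j ω => lap_le_one (f j ω))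
    simp only [Function.comp_apply] at hexp
    -- The identity becomes I + S = γ ∑_j Φ_{j-1}^{1,1} with finite right side, so I and S are
    -- finite and can be compared as real numbers.
    rw [hR.sum_setWeight hR₀, ← ofReal_measureReal, ← ENNReal.ofReal_mul' measureReal_nonneg]
      at hexp
    set I := ∫⁻ x, 1 - ∏ j, thin (lap (f j x.1)) x.2 ∂betaIntensity B₀ (structuralDist P₀ R)
    set S := ∑ H : {s : Finset (Fin n) // s.Nonempty},
      ENNReal.ofReal (setWeight α V H) * ∫⁻ ω, ∏ j ∈ H.1, lap (f j ω) ∂B₀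
    have hI : I ≠ ⊤ := fun h => by simp [h] at hexp
    have hS : S ≠ ⊤ := fun h => by simp [h] at hexp
    have hnn : 0 ≤ (∑ j ∈ Finset.Icc 1 n, primitive α V (j - 1) 1 1) * B₀.real Set.univ := by
      rw [← hR.sum_setWeight hR₀]
      exact mul_nonneg (Finset.sum_nonneg fun H _ => hR.setWeight_nonneg H) measureReal_nonneg
    have h1 := congrArg ENNReal.toReal hexp
    rw [ENNReal.toReal_add hI hS, ENNReal.toReal_ofReal hnn] at h1
    rw [← ENNReal.ofReal_toReal hI, lap_ofReal ENNReal.toReal_nonneg,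
      ← ENNReal.ofReal_mul (Real.exp_pos _).le, ← Real.exp_add]
    congr 2
    linarith
  have hP : IsProbabilityMeasure (P.map fun ξ (j : Fin n) => bernoulliProcess N X U j ξ) :=
    Measure.isProbabilityMeasure_map hZm.aemeasurable
  have hfin : IsFiniteMeasure
      (lawOfDensity (n := n) ((B₀ Set.univ)⁻¹ • B₀) (productDensity α V (B₀.real Set.univ))) := by
    -- Taking f = 0 shows that the candidate law has total mass 1, which supplies the finiteness
    -- required for uniqueness.
    have h1 := hLaw (fun _ _ => 0) fun _ => measurable_const
    simp only [lintegral_zero, Finset.sum_const_zero, lap_zero, lintegral_one, measure_univ] at h1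
    exact ⟨by rw [← h1]; exact ENNReal.one_lt_top⟩
  exact ⟨hZm.aemeasurable, ext_of_lintegral_lap_measures hLaw⟩
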